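/- Conventions. A mixed Hodge structure is a finitely generated abelian group $H_{et}$ with a finite increasing filtration $W$ of $H_{et}\otimes\mathbb{Q}$ and a finite decreasing filtration $F$ of $H_{\mathbb C}:=H_{et}\otimes\mathbb{C}$ such that $F$ induces a pure Hodge structure of weight $k$ on each $\mathrm{Gr}^W_k$; it has level $\le n$ if only types $(p,q)$ with $0\le p,q\le n$ occur. For $n>0$, a formal Hodge structure $(H,V)$ of level $\le n$ consists of a mixed Hodge structure $H_{et}$ of level $\le n$, a finite-dimensional $\mathbb{C}$-vector space $H^o$, finite-dimensional $\mathbb{C}$-vector spaces $V_1,\dots,V_n$ with linear maps $v_i:V_i\to V_{i-1}$ ($2\le i\le n$), linear maps $\pi_i:V_i\to H_{\mathbb C}/F^i$ compatible with the $v_i$ and the projections $H_{\mathbb C}/F^i\to H_{\mathbb C}/F^{i-1}$, a linear map $h^o:H^o\to V_n$, and a homomorphism $h_{et}:H_{et}\to V_n$ such that $\pi_n\circ h_{et}$ is the canonical map $H_{et}\to H_{\mathbb C}/F^n$. A morphism consists of a morphism of mixed Hodge structures $f_{et}$, a linear map $f^o$ and linear maps $\phi_i:V_i\to V'_i$ compatible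 with all these data. Let $\mathsf{FHS}_n$ be the resulting category and $\mathsf{MHS}$ the category of mixed Hodge structures; a sequence is short exact if it is so on underlying groups (in $\mathsf{MHS}$), respectively on all components $H_{et}$, $H^o$, $V_i$ (in $\mathsf{FHS}_n$). $\mathrm{Ext}^1(B,A)$ denotes the set of equivalence classes of extensions $0\to A\to E\to B\to 0$, which is an abelian group under the Baer sum. Proposition. Let $n>0$ and let $(H,V)$, $(H',V')$ be formal Hodge structures of level $\le n$ such that $H_{et}$ and $H'_{et}$ are torsion free. Then the Baer sum makes $\mathrm{Ext}^1_{\mathsf{FHS}_n}((H,V),(H',V'))$ and $\mathrm{Ext}^1_{\mathsf{MHS}}(H_{et},H'_{et})$ abelian groups, and the forgetful functor $(H,V)\mapsto H_{et}$, sending the class of an extension of formal Hodge structures to the class of the underlying extension of mixed Hodge structures, induces a surjective homomorphism of abelian groups $$\gamma:\mathrm{Ext}^1_{\mathsf{FHS}_n}((H,V),(H',V'))\longrightarrow \mathrm{Ext}^1_{\mathsf{MHS}}(H_{et},H'_{et}).$$ -/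

import Mathlib

open CategoryTheory CategoryTheory.Limits
open scoped TensorProduct

noncomputable section

/-! ### Mixed Hodge structures -/

/-- The map `ℚ ⊗ H → ℂ ⊗ H` induced by the inclusion of `ℚ` in `ℂ`. -/
def ratToComplex (H : Type) [AddCommGroup H] : ℚ ⊗[ℤ] H →ₗ[ℤ] ℂ ⊗[ℤ] H :=
  LinearMap.rTensor H (algebraMap ℚ ℂ).toAddMonoidHom.toIntLinearMap

/-- Complex conjugation `z ⊗ x ↦ conj z ⊗ x` on `ℂ ⊗ H`, as a semilinear map. -/
def conjC (H : Type) [AddCommGroup H] :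
    ℂ ⊗[ℤ] H →ₛₗ[starRingEnd ℂ] ℂ ⊗[ℤ] H where
  toFun := LinearMap.rTensor H (starRingEnd ℂ).toAddMonoidHom.toIntLinearMap
  map_add' := map_add _
  map_smul' c x := by
    induction x with
    | zero => simp
    | tmul z y => simp [TensorProduct.smul_tmul']
    | add x y hx hy => rw [smul_add, map_add, hx, hy, map_add, smul_add]

/-- The complexification of a rational subspace of `ℚ ⊗ H`, as a subspace of `ℂ ⊗ H`. -/
def complexify {H : Type} [AddCommGroup H] (S : Submodule ℚ (ℚ ⊗[ℤ] H)) :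
    Submodule ℂ (ℂ ⊗[ℤ] H) :=
  Submodule.span ℂ (ratToComplex H '' S)

/-- The graded piece `W_k / W_{k-1}` of an increasing filtration of `ℂ ⊗ H`. -/
abbrev GrPiece {H : Type} [AddCommGroup H] (W : ℤ → Submodule ℂ (ℂ ⊗[ℤ] H)) (k : ℤ) : Type :=
  ↥(W k) ⧸ (W (k - 1)).submoduleOf (W k)

/-- The subspace induced by `S` on `W_k / W_{k-1}`, i.e. the image of `S ∩ W_k`. -/
def grInduced {H : Type} [AddCommGroup H] (W : ℤ → Submodule ℂ (ℂ ⊗[ℤ] H)) (k : ℤ)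
    (S : Submodule ℂ (ℂ ⊗[ℤ] H)) : Submodule ℂ (GrPiece W k) :=
  (S.submoduleOf (W k)).map (Submodule.mkQ _)

/-- A mixed Hodge structure: a finitely generated abelian group `H` with a finite increasing
weight filtration `W` of `ℚ ⊗ H` and a finite decreasing Hodge filtration `F` of `ℂ ⊗ H`, such
that `F` induces on every `Gr^W_k` a pure Hodge structure of weight `k`, that is
`Gr^W_k = F^p Gr^W_k ⊕ conj (F^q Gr^W_k)` whenever `p + q = k + 1`. -/
structure MHS where
  H : Type
  [grp : AddCommGroup H]
  [fin : Module.Finite ℤ H]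
  W : ℤ → Submodule ℚ (ℚ ⊗[ℤ] H)
  F : ℤ → Submodule ℂ (ℂ ⊗[ℤ] H)
  W_mono : Monotone W
  W_bot : ∃ k, W k = ⊥
  W_top : ∃ k, W k = ⊤
  F_anti : Antitone F
  F_bot : ∃ p, F p = ⊥
  F_top : ∃ p, F p = ⊤
  opposed : ∀ k p q : ℤ, p + q = k + 1 →
    IsCompl (grInduced (fun j => complexify (W j)) k (F p))
      (grInduced (fun j => complexify (W j)) k ((F q).comap (conjC H)))

namespace MHS

attribute [instance] MHS.grp MHS.fin

/-- `H_ℂ = ℂ ⊗ H`. -/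
abbrev HC (A : MHS) : Type := ℂ ⊗[ℤ] A.H

/-- The Hodge component `H^{p,q}` of `Gr^W_{p+q}`. -/
def hodgePiece (A : MHS) (p q : ℤ) :
    Submodule ℂ (GrPiece (fun j => complexify (A.W j)) (p + q)) :=
  grInduced (fun j => complexify (A.W j)) (p + q) (A.F p) ⊓
    grInduced (fun j => complexify (A.W j)) (p + q) ((A.F q).comap (conjC A.H))

/-- Level `≤ n`: the only types `(p, q)` that occur satisfy `0 ≤ p, q ≤ n`. -/
def LevelLE (A : MHS) (n : ℕ) : Prop :=
  ∀ p q : ℤ, A.hodgePiece p q ≠ ⊥ → (0 ≤ p ∧ p ≤ n) ∧ (0 ≤ q ∧ q ≤ n)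

/-- A morphism of mixed Hodge structures: a homomorphism of groups compatible with `W` and `F`. -/
@[ext]
structure Hom (A B : MHS) where
  f : A.H →ₗ[ℤ] B.H
  map_W : ∀ k, A.W k ≤ (B.W k).comap (f.baseChange ℚ)
  map_F : ∀ p, A.F p ≤ (B.F p).comap (f.baseChange ℂ)

instance : Category MHS where
  Hom := Hom
  id A := ⟨LinearMap.id, fun k x hx => by simpa using hx, fun p x hx => by simpa using hx⟩
  comp g h := ⟨h.f ∘ₗ g.f,
    fun k x hx => by
      rw [LinearMap.baseChange_comp]; exact h.map_W k (g.map_W k hx),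
    fun p x hx => by
      rw [LinearMap.baseChange_comp]; exact h.map_F p (g.map_F p hx)⟩

instance : HasZeroMorphisms MHS where
  zero A B := ⟨⟨0, fun k x _ => by simp, fun p x _ => by simp⟩⟩
  comp_zero _ _ := Hom.ext (LinearMap.zero_comp _)
  zero_comp _ _ _ _ := Hom.ext (LinearMap.comp_zero _)

/-- The map `A_ℂ / F^p → B_ℂ / F^p` induced by a morphism. -/
def Hom.quot {A B : MHS} (g : Hom A B) (p : ℤ) : (A.HC ⧸ A.F p) →ₗ[ℂ] (B.HC ⧸ B.F p) :=
  Submodule.mapQ (A.F p) (B.F p) (g.f.baseChange ℂ) (g.map_F p)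

/-- The canonical map `H → H_ℂ / F^p`. -/
def toQuot (A : MHS) (p : ℤ) : A.H →ₗ[ℤ] (A.HC ⧸ A.F p) where
  toFun x := Submodule.Quotient.mk ((1 : ℂ) ⊗ₜ[ℤ] x)
  map_add' x y := by rw [TensorProduct.tmul_add]; rfl
  map_smul' c x := by rw [TensorProduct.tmul_smul]; rfl

/-- The projection `H_ℂ / F^q → H_ℂ / F^p` for `p ≤ q`. -/
def proj (A : MHS) {p q : ℤ} (h : p ≤ q) : (A.HC ⧸ A.F q) →ₗ[ℂ] (A.HC ⧸ A.F p) :=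
  Submodule.factor (A.F_anti h)

end MHS

/-! ### Formal Hodge structures -/

/-- A formal Hodge structure of level `≤ n`, where `n = m + 1`. The vector space called `V i` here,
for `i = 0, …, m`, is the space `V_{i+1}` of the diagram
`V_n → V_{n-1} → ⋯ → V_1`, and `Ho` is the connected component `H^o` of the formal group. -/
structure FHS (m : ℕ) where
  et : MHS
  level : et.LevelLE (m + 1)
  Ho : Type
  [grpHo : AddCommGroup Ho]
  [modHo : Module ℂ Ho]
  [finHo : Module.Finite ℂ Ho]
  V : Fin (m + 1) → Type
  [grpV : ∀ i, AddCommGroup (V i)]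
  [modV : ∀ i, Module ℂ (V i)]
  [finV : ∀ i, Module.Finite ℂ (V i)]
  v : ∀ i : Fin m, V i.succ →ₗ[ℂ] V i.castSucc
  π : ∀ i : Fin (m + 1), V i →ₗ[ℂ] (et.HC ⧸ et.F (((i : ℕ) : ℤ) + 1))
  het : et.H →+ V (Fin.last m)
  ho : Ho →ₗ[ℂ] V (Fin.last m)
  π_v : ∀ (i : Fin m) (x : V i.succ),
    π i.castSucc (v i x) = et.proj (by simp) (π i.succ x)
  π_het : ∀ x : et.H,
    π (Fin.last m) (het x) = et.toQuot (((Fin.last m : ℕ) : ℤ) + 1) x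

namespace FHS

attribute [instance] FHS.grpHo FHS.modHo FHS.finHo FHS.grpV FHS.modV FHS.finV

variable {m : ℕ}

/-- A morphism of formal Hodge structures. -/
@[ext]
structure Hom (X Y : FHS m) where
  et : X.et ⟶ Y.et
  o : X.Ho →ₗ[ℂ] Y.Ho
  φ : ∀ i, X.V i →ₗ[ℂ] Y.V i
  φ_v : ∀ (i : Fin m) (x : X.V i.succ), φ i.castSucc (X.v i x) = Y.v i (φ i.succ x)
  φ_π : ∀ (i : Fin (m + 1)) (x : X.V i), Y.π i (φ i x) = MHS.Hom.quot et _ (X.π i x)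
  φ_het : ∀ x : X.et.H, φ (Fin.last m) (X.het x) = Y.het (MHS.Hom.f et x)
  φ_ho : ∀ x : X.Ho, φ (Fin.last m) (X.ho x) = Y.ho (o x)

theorem quot_id (A : MHS) (p : ℤ) (x : A.HC ⧸ A.F p) : MHS.Hom.quot (𝟙 A) p x = x := by
  obtain ⟨y, rfl⟩ := Submodule.Quotient.mk_surjective _ x
  change Submodule.Quotient.mk ((LinearMap.id : A.H →ₗ[ℤ] A.H).baseChange ℂ y) = _
  simp

theorem quot_comp {A B C : MHS} (g : A ⟶ B) (h : B ⟶ C) (p : ℤ) (x : A.HC ⧸ A.F p) :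
    MHS.Hom.quot (g ≫ h) p x = MHS.Hom.quot h p (MHS.Hom.quot g p x) := by
  obtain ⟨y, rfl⟩ := Submodule.Quotient.mk_surjective _ x
  change Submodule.Quotient.mk (((MHS.Hom.f h) ∘ₗ (MHS.Hom.f g)).baseChange ℂ y) = _
  rw [LinearMap.baseChange_comp]
  rfl

theorem quot_zero {A B : MHS} (p : ℤ) (x : A.HC ⧸ A.F p) :
    MHS.Hom.quot (0 : A ⟶ B) p x = 0 := by
  obtain ⟨y, rfl⟩ := Submodule.Quotient.mk_surjective _ x
  change Submodule.Quotient.mk ((0 : A.H →ₗ[ℤ] B.H).baseChange ℂ y) = _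
  simp

instance : Category (FHS m) where
  Hom := Hom
  id X := ⟨𝟙 _, LinearMap.id, fun _ => LinearMap.id, fun _ _ => rfl,
    fun _ x => (quot_id _ _ _).symm, fun _ => rfl, fun _ => rfl⟩
  comp g h := ⟨g.et ≫ h.et, h.o ∘ₗ g.o, fun i => h.φ i ∘ₗ g.φ i,
    fun i x => by simp [g.φ_v, h.φ_v],
    fun i x => by simp [g.φ_π, h.φ_π, quot_comp],
    fun x => by simp only [LinearMap.comp_apply, g.φ_het, h.φ_het]; rfl,
    fun x => by simp [g.φ_ho, h.φ_ho]⟩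

instance : HasZeroMorphisms (FHS m) where
  zero X Y := ⟨⟨0, 0, fun _ => 0, fun _ _ => by simp,
    fun i x => by rw [quot_zero]; simp,
    fun x => (Y.het.map_zero).symm, fun x => by simp⟩⟩
  comp_zero g Z := Hom.ext (comp_zero (f := g.et)) (LinearMap.zero_comp _)
    (funext fun _ => LinearMap.zero_comp _)
  zero_comp X _ _ g := Hom.ext (zero_comp (f := g.et)) (LinearMap.comp_zero _)
    (funext fun _ => LinearMap.comp_zero _)

/-- The forgetful functor `(H, V) ↦ H_et`. -/
def forget (m : ℕ) : FHS m ⥤ MHS where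
  obj X := X.et
  map g := Hom.et g

end FHS

/-! ### Extensions -/

/-- The short exact sequences `0 → A → E → B → 0` of a category. -/
class HasShortExact (C : Type 1) [Category.{0} C] where
  shortExact : ∀ {A E B : C}, (A ⟶ E) → (E ⟶ B) → Prop

/-- A sequence of mixed Hodge structures is short exact if the sequence of abelian groups is. -/
instance : HasShortExact MHS where
  shortExact i p := Function.Injective (MHS.Hom.f i) ∧
    Function.Exact (MHS.Hom.f i) (MHS.Hom.f p) ∧ Function.Surjective (MHS.Hom.f p)

/-- A sequence of formal Hodge structures is short exact if all its components (the sequences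
of the `H_et`, of the `H^o` and of every `V_i`) are. -/
instance {m : ℕ} : HasShortExact (FHS m) where
  shortExact i p :=
    HasShortExact.shortExact (FHS.Hom.et i) (FHS.Hom.et p) ∧
    (Function.Injective (FHS.Hom.o i) ∧ Function.Exact (FHS.Hom.o i) (FHS.Hom.o p) ∧
      Function.Surjective (FHS.Hom.o p)) ∧
    ∀ j, Function.Injective (FHS.Hom.φ i j) ∧ Function.Exact (FHS.Hom.φ i j) (FHS.Hom.φ p j) ∧
      Function.Surjective (FHS.Hom.φ p j)

/-- An extension `0 → A → E → B → 0` of `B` by `A`. -/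
structure Extn {C : Type 1} [Category.{0} C] [HasShortExact C] (B A : C) where
  E : C
  i : A ⟶ E
  p : E ⟶ B
  exact : HasShortExact.shortExact i p

namespace Extn

variable {C : Type 1} [Category.{0} C] [HasShortExact C] {B A : C}

/-- Equivalence of extensions: an isomorphism of the middle terms that is compatible with the
identities of `A` and `B`. -/
instance setoid (B A : C) : Setoid (Extn B A) where
  r X Y := ∃ e : X.E ≅ Y.E, X.i ≫ e.hom = Y.i ∧ e.hom ≫ Y.p = X.p
  iseqv :=
    { refl := fun X => ⟨Iso.refl _, by simp, by simp⟩
      symm := fun {X Y} ⟨e, h₁, h₂⟩ => ⟨e.symm, by simp [← h₁], by simp [← h₂]⟩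
      trans := fun {X Y Z} ⟨e, h₁, h₂⟩ ⟨e', h₁', h₂'⟩ =>
        ⟨e ≪≫ e', by simp [← h₁', ← h₁], by simp [← h₂, ← h₂']⟩ }

/-- `Z` is the Baer sum of `X` and `Y`. Here `P` is the fibre product of the middle terms of `X`
and `Y` over `B`, an extension of `B` by `A ⊕ A` (with the inclusions `j₁`, `j₂` of the two
summands), and `s` is a morphism of extensions from `P` to `Z` over the sum map `A ⊕ A → A` and
the identity of `B`; so `Z` is the pushout of `P` along the sum map. -/
def IsBaerSum [HasZeroMorphisms C] (X Y Z : Extn B A) : Prop :=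
  ∃ (P : C) (q₁ : P ⟶ X.E) (q₂ : P ⟶ Y.E) (j₁ j₂ : A ⟶ P) (s : P ⟶ Z.E),
    IsPullback q₁ q₂ X.p Y.p ∧
    (j₁ ≫ q₁ = X.i ∧ j₁ ≫ q₂ = 0) ∧ (j₂ ≫ q₁ = 0 ∧ j₂ ≫ q₂ = Y.i) ∧
    j₁ ≫ s = Z.i ∧ j₂ ≫ s = Z.i ∧ s ≫ Z.p = q₁ ≫ X.p

end Extn

/-- The Yoneda extensions `Ext¹(B, A)`: equivalence classes of extensions of `B` by `A`. -/
def Ext1 {C : Type 1} [Category.{0} C] [HasShortExact C] (B A : C) : Type 1 :=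
  Quotient (Extn.setoid B A)

/-- The class of an extension. -/
def Extn.cls {C : Type 1} [Category.{0} C] [HasShortExact C] {B A : C} (X : Extn B A) :
    Ext1 B A :=
  Quotient.mk _ X

/-- The extension of mixed Hodge structures underlying an extension of formal Hodge structures. -/
def Extn.forget {m : ℕ} {X Y : FHS m} (T : Extn X Y) :
    Extn ((FHS.forget m).obj X) ((FHS.forget m).obj Y) where
  E := (FHS.forget m).obj T.E
  i := (FHS.forget m).map T.i
  p := (FHS.forget m).map T.p
  exact := T.exact.1

end

/-! The proof rests on strictness, on a formal treatment of the Baer sum, and on the surjectivity of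
the maps `π i`.

Strictness. Let `G` be the complex conjugate of the Hodge filtration `F`. For p + q = k + 1,
opposedness on the graded pieces gives W_k = (F^p ∩ W_k) ⊕ N, where N is the sum of the G^(q-j) ∩
W_(k-j) over j ≥ 0 (`IsMixed.exists_add`, `IsMixed.eq_zero`). Since N is built from the filtrations
alone, morphisms respect this decomposition, and strictness for `W` and `F` follows. Hence kernels
and cokernels carry mixed Hodge structures, bijective morphisms are isomorphisms, and H ↦ H_ℂ/F^p is
exact.

Baer sum. In both categories an extension has a pushout along any morphism, unique up to
equivalence, and fibre products over B identify Ext¹(B, A ⊕ A') with Ext¹(B, A) × Ext¹(B, A'). This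
gives f_* w + g_* w = (f + g)_* w (`ExtnSums.add_push`). Finitely many classes are always pushouts
of a single one, so the group axioms reduce to those for morphisms. The sum is characterised by
morphisms of extensions, which the forgetful functor preserves, so the induced map is additive.

Surjectivity. Every `π i` is surjective (`FHS.π_surjective`). Given an extension E of the étale part
of X by that of Y, take direct sums for the `Ho` and `V` components. Lift the maps `X.π i` to maps
ρ_i into the quotients of E_ℂ. The failure of ρ to commute with `v` comes from the quotients of Y_ℂ,
hence lifts along `Y.π` to an off-diagonal entry of `v`. A group-theoretic splitting of E, available
because the étale part of X is free, corrected in the same way, supplies `het`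
(`FHS.exists_forget_eq`). -/

noncomputable section

/-! ### Opposed filtrations -/

section Opposed

variable {R U V V' : Type*} [Ring R] [AddCommGroup U] [Module R U] [AddCommGroup V] [Module R V]
  [AddCommGroup V'] [Module R V']

/-- The subspaces induced by `F p` and `G q` on `W k / W (k - 1)` meet in zero. -/
def Separated (W F G : ℤ → Submodule R V) (k p q : ℤ) : Prop :=
  ∀ x ∈ F p ⊓ W k, ∀ y ∈ G q ⊓ W k, x - y ∈ W (k - 1) → x ∈ W (k - 1)

/-- Three finite filtrations, `W` increasing and `F`, `G` decreasing, such that `F` and `G` induce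
`k`-opposed filtrations on `W k / W (k - 1)`. -/
structure IsMixed (W F G : ℤ → Submodule R V) : Prop where
  W_mono : Monotone W
  W_bot : ∃ k, W k = ⊥
  W_top : ∃ k, W k = ⊤
  F_anti : Antitone F
  F_bot : ∃ p, F p = ⊥
  F_top : ∃ p, F p = ⊤
  G_anti : Antitone G
  G_bot : ∃ p, G p = ⊥
  G_top : ∃ p, G p = ⊤
  decomp : ∀ k p q : ℤ, p + q = k + 1 → ∀ z ∈ W k,
    ∃ x ∈ F p ⊓ W k, ∃ y ∈ G q ⊓ W k, z - (x + y) ∈ W (k - 1)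
  sep : ∀ k p q : ℤ, p + q = k + 1 → Separated W F G k p q

/-- A linear map compatible with three filtrations. -/
structure IsFiltered (W F G : ℤ → Submodule R V) (W' F' G' : ℤ → Submodule R V')
    (g : V →ₗ[R] V') : Prop where
  map_W : ∀ k, ∀ x ∈ W k, g x ∈ W' k
  map_F : ∀ k, ∀ x ∈ F k, g x ∈ F' k
  map_G : ∀ k, ∀ x ∈ G k, g x ∈ G' k

variable {W F G : ℤ → Submodule R V} {W' F' G' : ℤ → Submodule R V'} {g : V →ₗ[R] V'}

theorem Separated.swap {k p q : ℤ} (h : Separated W F G k p q) : Separated W G F k q p := by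
  intro y hy x hx hyx
  have hxy : x - y ∈ W (k - 1) := by simpa using neg_mem hyx
  simpa using sub_mem (h x hx y hy hxy) hxy

/-- Thanks to this symmetry, each strictness statement for the Hodge filtration also holds for its
conjugate. -/
theorem IsMixed.swap (h : IsMixed W F G) : IsMixed W G F where
  W_mono := h.W_mono
  W_bot := h.W_bot
  W_top := h.W_top
  F_anti := h.G_anti
  F_bot := h.G_bot
  F_top := h.G_top
  G_anti := h.F_anti
  G_bot := h.F_bot
  G_top := h.F_top
  decomp k p q hpq z hz := by
    obtain ⟨x, hx, y, hy, hxy⟩ := h.decomp k q p (by omega) z hz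
    exact ⟨y, hy, x, hx, by rwa [add_comm]⟩
  sep k p q hpq := (h.sep k q p (by omega)).swap

theorem IsFiltered.swap (h : IsFiltered W F G W' F' G' g) : IsFiltered W G F W' G' F' g :=
  ⟨h.map_W, h.map_G, h.map_F⟩

/-! ### A functorial complement of `F p ⊓ W k` in `W k`, and strictness -/

/-- The sum of the subspaces `G (q - j) ∩ W (k - j)` for `j ≥ 0`. -/
def diagSum (W G : ℤ → Submodule R V) (k q : ℤ) : Submodule R V :=
  ⨆ j : ℕ, G (q - j) ⊓ W (k - j)

/-- Splitting off the term j = 0 gives the recursion that drives the inductions on the weight. -/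
theorem diagSum_eq (W G : ℤ → Submodule R V) (k q : ℤ) :
    diagSum W G k q = G q ⊓ W k ⊔ diagSum W G (k - 1) (q - 1) := by
  unfold diagSum
  rw [← sup_iSup_nat_succ]
  have h : ∀ a : ℤ, ∀ i : ℕ, a - ((i + 1 : ℕ) : ℤ) = a - 1 - (i : ℤ) := fun a i => by
    push_cast; ring
  simp only [h]
  simp

theorem le_diagSum (W G : ℤ → Submodule R V) (k q : ℤ) : G q ⊓ W k ≤ diagSum W G k q := by
  rw [diagSum_eq]; exact le_sup_left

/-- A diagonal is a tail of any diagonal that starts higher on the same line; this lets complements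
at different weights be compared. -/
theorem diagSum_le_diagSum_add (W G : ℤ → Submodule R V) (k q : ℤ) (j : ℕ) :
    diagSum W G k q ≤ diagSum W G (k + j) (q + j) := by
  induction j with
  | zero => simp
  | succ j ih =>
    refine ih.trans ?_
    rw [diagSum_eq W G (k + (j + 1 : ℕ))]
    have h : ∀ a : ℤ, a + ((j + 1 : ℕ) : ℤ) - 1 = a + j := fun a => by push_cast; ring
    rw [h, h]
    exact le_sup_right

theorem diagSum_le (hW : Monotone W) (k q : ℤ) : diagSum W G k q ≤ W k :=
  iSup_le fun _ => inf_le_right.trans (hW (by omega))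

/-- The complement involves no choice, so it is functorial; strictness comes from this. -/
theorem IsFiltered.map_diagSum (h : IsFiltered W F G W' F' G' g) {k q : ℤ} {x : V}
    (hx : x ∈ diagSum W G k q) : g x ∈ diagSum W' G' k q := by
  suffices diagSum W G k q ≤ (diagSum W' G' k q).comap g from this hx
  refine iSup_le fun j => ?_
  rintro y ⟨hy, hy'⟩
  exact (le_iSup (fun j : ℕ => G' (q - j) ⊓ W' (k - j)) j) ⟨h.map_G _ y hy, h.map_W _ y hy'⟩

/-- The base case covers every weight where `W` vanishes, which by monotonicity includes all
sufficiently low ones. -/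
theorem IsMixed.W_induction (h : IsMixed W F G) {P : ℤ → Prop} (h0 : ∀ k, W k = ⊥ → P k)
    (hs : ∀ k, P (k - 1) → P k) (k : ℤ) : P k := by
  obtain ⟨b, hb⟩ := h.W_bot
  obtain hk | hk := le_total k b
  · exact h0 k (le_bot_iff.1 (hb ▸ h.W_mono hk))
  · induction k, hk using Int.leInduction with
    | base => exact h0 b hb
    | succ k _ ih => exact hs _ (by simpa using ih)

/-- Opposedness splits z up to an error in `W (k - 1)`; the error is split inductively with the same
p and with q lowered by one, so that p + q = k + 1 persists. -/
theorem IsMixed.exists_add (h : IsMixed W F G) (k : ℤ) : ∀ p q : ℤ, p + q = k + 1 → ∀ z ∈ W k,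
    ∃ x ∈ F p ⊓ W k, ∃ y ∈ diagSum W G k q, x + y = z := by
  induction k using h.W_induction with
  | h0 k hk =>
    intro p q _ z hz
    rw [hk, Submodule.mem_bot] at hz
    exact ⟨0, zero_mem _, 0, zero_mem _, by simp [hz]⟩
  | hs k ih =>
    intro p q hpq z hz
    obtain ⟨x, hx, y, hy, hxy⟩ := h.decomp k p q hpq z hz
    obtain ⟨x', hx', y', hy', he⟩ := ih p (q - 1) (by omega) _ hxy
    refine ⟨x + x', add_mem hx ⟨hx'.1, h.W_mono (by omega) hx'.2⟩, y + y', ?_, ?_⟩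
    · rw [diagSum_eq]
      exact Submodule.add_mem_sup hy hy'
    · rw [add_add_add_comm, he]; abel

/-- With `IsMixed.exists_add`, this makes `diagSum W G k q` a complement of `F p ⊓ W k` in `W k`.
Separatedness pushes a common element down one weight at a time, until `W` vanishes. -/
theorem IsMixed.eq_zero (h : IsMixed W F G) (k : ℤ) : ∀ p q : ℤ, p + q = k + 1 → ∀ x ∈ F p,
    x ∈ diagSum W G k q → x = 0 := by
  induction k using h.W_induction with
  | h0 k hk =>
    intro p q _ x _ hx
    simpa [hk] using diagSum_le h.W_mono _ _ hx
  | hs k ih =>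
    intro p q hpq x hx hx'
    have hxk := diagSum_le h.W_mono _ _ hx'
    rw [diagSum_eq] at hx'
    obtain ⟨y, hy, n, hn, rfl⟩ := Submodule.mem_sup.1 hx'
    have hnk := diagSum_le h.W_mono _ _ hn
    have h1 := h.sep k p q hpq _ ⟨hx, hxk⟩ y hy (by simpa using hnk)
    have hy1 : y ∈ W (k - 1) := by simpa using sub_mem h1 hnk
    -- Since `G q ≤ G (q - 1)`, the leading term y is absorbed into the diagonal of weight k - 1.
    refine ih p (q - 1) (by omega) _ hx (add_mem ?_ hn)
    exact le_diagSum _ _ _ _ ⟨h.G_anti (by omega) hy.1, hy1⟩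

/-- Simultaneous strictness for `W` and `F`, for elements known to lie in `W k`. -/
theorem IsMixed.strict_F (h : IsMixed W F G) (h' : IsMixed W' F' G')
    (hg : IsFiltered W F G W' F' G' g) {k p : ℤ} {x : V} (hx : x ∈ W k) (hgx : g x ∈ F' p) :
    ∃ y ∈ F p ⊓ W k, g y = g x := by
  obtain ⟨f, hf, n, hn, rfl⟩ := h.exists_add k p (k + 1 - p) (by omega) x hx
  refine ⟨f, hf, ?_⟩
  -- The component of g x in the complement also lies in `F' p`, hence vanishes.
  have : g n ∈ F' p := by simpa using sub_mem hgx (hg.map_F _ f hf.1)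
  simp [h'.eq_zero k p (k + 1 - p) (by omega) _ this (hg.map_diagSum hn)]

/-- The induction runs downwards along the Hodge filtration: an element of `F p ⊓ W k` is traded for
one of `F (p + 1) ⊓ W k` plus an element with the image of one in `W (k - 1)`, until `F` vanishes.
-/
theorem IsMixed.strict_W_step (h : IsMixed W F G) (h' : IsMixed W' F' G')
    (hg : IsFiltered W F G W' F' G' g) {k : ℤ} {x : V} (hx : x ∈ W k) (hgx : g x ∈ W' (k - 1)) :
    ∃ y ∈ W (k - 1), g y = g x := by
  obtain ⟨a, ha⟩ := h.F_top
  obtain ⟨b, hb⟩ := h.F_bot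
  suffices H : ∀ n : ℕ, ∀ p, b ≤ p + n → ∀ x ∈ F p ⊓ W k, g x ∈ W' (k - 1) →
      ∃ y ∈ W (k - 1), g y = g x from
    H (b - a).toNat a (by omega) x ⟨ha ▸ trivial, hx⟩ hgx
  clear hx hgx x
  intro n
  induction n with
  | zero =>
    intro p hp x hx _
    have : x ∈ F b := h.F_anti (by simpa using hp) hx.1
    rw [hb, Submodule.mem_bot] at this
    exact ⟨0, zero_mem _, by simp [this]⟩
  | succ n ih =>
    intro p hp x hx hgx
    obtain ⟨x₁, h₁, x₂, h₂, hw⟩ := h.decomp k (p + 1) (k - p) (by omega) x hx.2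
    -- Modulo `W' (k - 1)` the images of x₁ and -x₂ agree, and they lie in opposed subspaces of the
    -- graded piece.
    have hg₁ : g x₁ ∈ W' (k - 1) := by
      refine h'.sep k (p + 1) (k - p) (by omega) _ ⟨hg.map_F _ _ h₁.1, hg.map_W _ _ h₁.2⟩ (-g x₂)
        (neg_mem ⟨hg.map_G _ _ h₂.1, hg.map_W _ _ h₂.2⟩) ?_
      have := sub_mem hgx (hg.map_W _ _ hw)
      simpa using this
    have hg₂ : g x₂ ∈ W' (k - 1) := by
      have := sub_mem (sub_mem hgx (hg.map_W _ _ hw)) hg₁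
      simpa using this
    obtain ⟨y₁, hy₁, e₁⟩ := ih (p + 1) (by push_cast at hp ⊢; omega) x₁ h₁ hg₁
    obtain ⟨f, hf, c, hc, e⟩ := h.exists_add (k - 1) p (k - p) (by omega) _ hw
    -- The remainder x - x₁ - f equals x₂ + c. Although x₂ need not lie in `W (k - 1)`, its image
    -- does, so the image of the remainder lies both in `F' p` and in its complement at weight k -
    -- 1.
    have hz : g (x - x₁ - f) = 0 := by
      refine h'.eq_zero (k - 1) p (k - p) (by omega) _ (hg.map_F _ _ ?_) ?_
      · exact sub_mem (sub_mem hx.1 (h.F_anti (by omega) h₁.1)) hf.1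
      · have : x - x₁ - f = x₂ + c := by rw [eq_sub_iff_add_eq] at e; rw [← e]; abel
        rw [this, map_add]
        exact add_mem (le_diagSum _ _ _ _ ⟨hg.map_G _ _ h₂.1, hg₂⟩) (hg.map_diagSum hc)
    refine ⟨y₁ + f, add_mem hy₁ hf.2, ?_⟩
    rw [map_sub, map_sub, sub_eq_zero] at hz
    rw [map_add, e₁, ← hz]; abel

theorem IsMixed.exists_mem_W (h : IsMixed W F G) (k : ℤ) : ∃ l, k ≤ l ∧ W l = ⊤ := by
  obtain ⟨t, ht⟩ := h.W_top
  exact ⟨max k t, le_max_left _ _, top_le_iff.1 (ht ▸ h.W_mono (le_max_right _ _))⟩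

/-- A compatible map is strict for `W`. -/
theorem IsMixed.strict_W (h : IsMixed W F G) (h' : IsMixed W' F' G')
    (hg : IsFiltered W F G W' F' G' g) {k : ℤ} {x : V} (hgx : g x ∈ W' k) :
    ∃ y ∈ W k, g y = g x := by
  obtain ⟨l, hkl, hl⟩ := h.exists_mem_W k
  have hx : x ∈ W l := hl ▸ trivial
  obtain ⟨n, rfl⟩ := Int.le.dest hkl
  clear hl hkl
  induction n generalizing x with
  | zero => exact ⟨x, by simpa using hx, rfl⟩
  | succ n ih =>
    have e : k + ((n + 1 : ℕ) : ℤ) - 1 = k + n := by push_cast; ring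
    obtain ⟨y, hy, hyx⟩ := h.strict_W_step h' hg hx (h'.W_mono (by omega) hgx)
    rw [e] at hy
    obtain ⟨z, hz, hzy⟩ := ih (hyx ▸ hgx) hy
    exact ⟨z, hz, hzy.trans hyx⟩

/-- A compatible map is simultaneously strict for `W` and `F`. -/
theorem IsMixed.strict (h : IsMixed W F G) (h' : IsMixed W' F' G')
    (hg : IsFiltered W F G W' F' G' g) {k p : ℤ} {x : V} (hx : g x ∈ F' p ⊓ W' k) :
    ∃ y ∈ F p ⊓ W k, g y = g x := by
  obtain ⟨y, hy, e⟩ := h.strict_W h' hg hx.2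
  obtain ⟨z, hz, e'⟩ := h.strict_F h' hg hy (e ▸ hx.1)
  exact ⟨z, hz, e'.trans e⟩

/-- A compatible map is strict for `F`. -/
theorem IsMixed.strict_F' (h : IsMixed W F G) (h' : IsMixed W' F' G')
    (hg : IsFiltered W F G W' F' G' g) {p : ℤ} {x : V} (hx : g x ∈ F' p) :
    ∃ y ∈ F p, g y = g x := by
  obtain ⟨l, hl⟩ := h.W_top
  obtain ⟨y, hy, e⟩ := h.strict_F h' hg (k := l) (hl ▸ trivial) hx
  exact ⟨y, hy.1, e⟩

/-- Modulo the range of a compatible map, an element of both `F p` and `W k` lies in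
`F p ∩ W k`. -/
theorem IsMixed.exists_sub_mem (h : IsMixed W F G) (h' : IsMixed W' F' G')
    (hg : IsFiltered W F G W' F' G' g) {k p : ℤ} {x w : V'} {a : V} (hx : x ∈ F' p) (hw : w ∈ W' k)
    (e : x - w = g a) : ∃ b, x - g b ∈ F' p ⊓ W' k := by
  obtain ⟨l, hkl, hl⟩ := h.exists_mem_W k
  obtain ⟨n, rfl⟩ := Int.le.dest hkl
  -- The weight k + n is large enough to contain a. Both complementary parts d and g c then lie on
  -- the diagonal of weight k + n, which meets `F' p` only in zero.
  obtain ⟨b, hb, c, hc, rfl⟩ := h.exists_add (k + n) p (k + 1 - p + n) (by omega) a (hl ▸ trivial)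
  obtain ⟨f, hf, d, hd, rfl⟩ := h'.exists_add k p (k + 1 - p) (by omega) w hw
  refine ⟨b, ?_⟩
  have e' : x - g b - f = d + g c := by
    rw [map_add, sub_eq_iff_eq_add] at e; rw [e]; abel
  have h0 : x - g b - f = 0 := by
    refine h'.eq_zero (k + n) p (k + 1 - p + n) (by omega) _
      (sub_mem (sub_mem hx (hg.map_F _ _ hb.1)) hf.1) ?_
    rw [e']
    exact add_mem (diagSum_le_diagSum_add _ _ _ _ _ hd) (hg.map_diagSum hc)
  rwa [sub_eq_zero.1 h0]

/-! ### Induced filtrations on kernels, cokernels, products and extensions -/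

theorem Separated.comap {j : U →ₗ[R] V} {k p q : ℤ} (h : Separated W F G k p q) :
    Separated (fun k => (W k).comap j) (fun k => (F k).comap j) (fun k => (G k).comap j) k p q := by
  intro x hx y hy hxy
  exact h (j x) hx (j y) hy (by simpa using hxy)

/-- The filtrations induced on the kernel of a compatible map. -/
theorem IsMixed.comap (h : IsMixed W F G) (h' : IsMixed W' F' G')
    (hg : IsFiltered W F G W' F' G' g) {j : U →ₗ[R] V} (hj : Function.Injective j)
    (hjg : Function.Exact j g) :
    IsMixed (fun k => (W k).comap j) (fun k => (F k).comap j) (fun k => (G k).comap j) where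
  W_mono _ _ hkl := Submodule.comap_mono (h.W_mono hkl)
  W_bot := h.W_bot.imp fun k hk => by simp [hk, LinearMap.ker_eq_bot.2 hj]
  W_top := h.W_top.imp fun k hk => by simp [hk]
  F_anti _ _ hkl := Submodule.comap_mono (h.F_anti hkl)
  F_bot := h.F_bot.imp fun k hk => by simp [hk, LinearMap.ker_eq_bot.2 hj]
  F_top := h.F_top.imp fun k hk => by simp [hk]
  G_anti _ _ hkl := Submodule.comap_mono (h.G_anti hkl)
  G_bot := h.G_bot.imp fun k hk => by simp [hk, LinearMap.ker_eq_bot.2 hj]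
  G_top := h.G_top.imp fun k hk => by simp [hk]
  decomp k p q hpq z hz := by
    obtain ⟨x, hx, y, hy, hw⟩ := h.decomp k p q hpq (j z) hz
    have hgw : -g x - g y ∈ W' (k - 1) := by
      simpa [hjg.apply_apply_eq_zero, neg_add_eq_sub, ← sub_eq_add_neg, sub_sub,
        add_comm] using hg.map_W _ _ hw
    have hgx : g x ∈ W' (k - 1) :=
      h'.sep k p q hpq _ ⟨hg.map_F _ _ hx.1, hg.map_W _ _ hx.2⟩ (-g y)
        (neg_mem ⟨hg.map_G _ _ hy.1, hg.map_W _ _ hy.2⟩) (by simpa [add_comm] using neg_mem hgw)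
    have hgy : g y ∈ W' (k - 1) := by simpa using neg_mem (add_mem hgw hgx)
    -- The two pieces of j z need not lie in the kernel of g, but their images have weight k - 1.
    -- Strictness for two filtrations at once corrects them by elements of weight k - 1, without
    -- leaving `F p` or `G q`.
    obtain ⟨x', hx', ex⟩ := h.strict h' hg (k := k - 1) ⟨hg.map_F _ _ hx.1, hgx⟩
    obtain ⟨y', hy', ey⟩ := h.swap.strict h'.swap hg.swap (k := k - 1) ⟨hg.map_G _ _ hy.1, hgy⟩
    obtain ⟨u, hu⟩ := (hjg (x - x')).1 (by simp [ex])
    obtain ⟨v, hv⟩ := (hjg (y - y')).1 (by simp [ey])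
    have hle : W (k - 1) ≤ W k := h.W_mono (by omega)
    refine ⟨u, ?_, v, ?_, ?_⟩
    · change j u ∈ F p ⊓ W k
      rw [hu]; exact sub_mem hx ⟨hx'.1, hle hx'.2⟩
    · change j v ∈ G q ⊓ W k
      rw [hv]; exact sub_mem hy ⟨hy'.1, hle hy'.2⟩
    · change j (z - (u + v)) ∈ W (k - 1)
      have : j (z - (u + v)) = j z - (x + y) + (x' + y') := by
        rw [map_sub, map_add, hu, hv]; abel
      rw [this]
      exact add_mem hw (add_mem hx'.2 hy'.2)
  sep k p q hpq := (h.sep k p q hpq).comap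

/-- On a cokernel, the image of an intersection is the intersection of the images: two lifts of z
differ by an element of the range of g, which `IsMixed.exists_sub_mem` absorbs. -/
theorem IsMixed.map_inf (h : IsMixed W F G) (h' : IsMixed W' F' G')
    (hg : IsFiltered W F G W' F' G' g) {r : V' →ₗ[R] U} (hr : Function.Exact g r) {k p : ℤ}
    {z : U} (hz : z ∈ (F' p).map r) (hz' : z ∈ (W' k).map r) : ∃ x ∈ F' p ⊓ W' k, r x = z := by
  obtain ⟨x, hx, rfl⟩ := hz
  obtain ⟨w, hw, e⟩ := hz'
  obtain ⟨a, ha⟩ := (hr (x - w)).1 (by simp [e])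
  obtain ⟨b, hb⟩ := h.exists_sub_mem h' hg hx hw ha.symm
  exact ⟨_, hb, by simp [hr.apply_apply_eq_zero]⟩

/-- The bound p + q ≤ k + 1 covers both uses: opposedness, where p + q = k + 1, and the vanishing of
Hodge components, where p + q = k. -/
theorem Separated.map (h : IsMixed W F G) (h' : IsMixed W' F' G')
    (hg : IsFiltered W F G W' F' G' g) {r : V' →ₗ[R] U} (hr : Function.Exact g r) {k p q : ℤ}
    (hs : Separated W' F' G' k p q) (hpq : p + q ≤ k + 1) :
    Separated (fun k => (W' k).map r) (fun k => (F' k).map r) (fun k => (G' k).map r) k p q := by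
  intro x₀ hx₀ y₀ hy₀ hxy
  obtain ⟨x, hx, rfl⟩ := h.map_inf h' hg hr hx₀.1 hx₀.2
  obtain ⟨y, hy, rfl⟩ := h.swap.map_inf h'.swap hg.swap hr hy₀.1 hy₀.2
  obtain ⟨w, hw, e⟩ := hxy
  obtain ⟨a, ha⟩ := (hr (x - y - w)).1 (by simp [e])
  have hle : W' (k - 1) ≤ W' k := h'.W_mono (by omega)
  obtain ⟨a', ha', ea⟩ := h.strict_W h' hg (k := k) (x := a)
    (ha ▸ sub_mem (sub_mem hx.2 hy.2) (hle hw))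
  -- The discrepancy g a' is split between x and y, which then agree modulo `W' (k - 1)`. The
  -- inequality on p + q gives `G (k + 1 - p) ≤ G q`.
  obtain ⟨u, hu, v, hv, hw'⟩ := h.decomp k p (k + 1 - p) (by omega) a' ha'
  have hv' : g v ∈ G' q ⊓ W' k :=
    ⟨hg.map_G _ _ (h.G_anti (by omega) hv.1), hg.map_W _ _ hv.2⟩
  have hu' : g u ∈ F' p ⊓ W' k := ⟨hg.map_F _ _ hu.1, hg.map_W _ _ hu.2⟩
  have key := hs (x - g u) (sub_mem hx hu') (y + g v) (add_mem hy hv') (by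
    have : x - g u - (y + g v) = g (a' - (u + v)) + w := by
      rw [map_sub, ea, ha, map_add]; abel
    rw [this]
    exact add_mem (hg.map_W _ _ hw') hw)
  exact ⟨_, key, by simp [hr.apply_apply_eq_zero]⟩

/-- The filtrations induced on the cokernel of a compatible map. -/
theorem IsMixed.map (h : IsMixed W F G) (h' : IsMixed W' F' G')
    (hg : IsFiltered W F G W' F' G' g) {r : V' →ₗ[R] U} (hr : Function.Exact g r)
    (hs : Function.Surjective r) :
    IsMixed (fun k => (W' k).map r) (fun k => (F' k).map r) (fun k => (G' k).map r) where
  W_mono _ _ hkl := Submodule.map_mono (h'.W_mono hkl)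
  W_bot := h'.W_bot.imp fun k hk => by simp [hk]
  W_top := h'.W_top.imp fun k hk => by simp [hk, LinearMap.range_eq_top.2 hs]
  F_anti _ _ hkl := Submodule.map_mono (h'.F_anti hkl)
  F_bot := h'.F_bot.imp fun k hk => by simp [hk]
  F_top := h'.F_top.imp fun k hk => by simp [hk, LinearMap.range_eq_top.2 hs]
  G_anti _ _ hkl := Submodule.map_mono (h'.G_anti hkl)
  G_bot := h'.G_bot.imp fun k hk => by simp [hk]
  G_top := h'.G_top.imp fun k hk => by simp [hk, LinearMap.range_eq_top.2 hs]
  decomp k p q hpq z hz := by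
    obtain ⟨z, hz, rfl⟩ := hz
    obtain ⟨x, hx, y, hy, hw⟩ := h'.decomp k p q hpq z hz
    exact ⟨r x, ⟨⟨x, hx.1, rfl⟩, ⟨x, hx.2, rfl⟩⟩, r y, ⟨⟨y, hy.1, rfl⟩, ⟨y, hy.2, rfl⟩⟩,
      _, hw, by simp⟩
  sep k p q hpq := Separated.map h h' hg hr (h'.sep k p q hpq) hpq.le

theorem Separated.prod {f : U →ₗ[R] V} {f' : U →ₗ[R] V'} {k p q : ℤ}
    (h : Separated W F G k p q) (h' : Separated W' F' G' k p q) :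
    Separated (fun k => (W k).comap f ⊓ (W' k).comap f') (fun k => (F k).comap f ⊓ (F' k).comap f')
      (fun k => (G k).comap f ⊓ (G' k).comap f') k p q := by
  rintro x ⟨hx, hx'⟩ y ⟨hy, hy'⟩ hxy
  exact ⟨h (f x) ⟨hx.1, hx'.1⟩ (f y) ⟨hy.1, hy'.1⟩ (by simpa using hxy.1),
    h' (f' x) ⟨hx.2, hx'.2⟩ (f' y) ⟨hy.2, hy'.2⟩ (by simpa using hxy.2)⟩

theorem exists_monotone_eq_bot {W : ℤ → Submodule R V} {W' : ℤ → Submodule R V'} (hW : Monotone W)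
    (hW' : Monotone W') (h : ∃ k, W k = ⊥) (h' : ∃ k, W' k = ⊥) : ∃ k, W k = ⊥ ∧ W' k = ⊥ := by
  obtain ⟨a, ha⟩ := h
  obtain ⟨b, hb⟩ := h'
  exact ⟨min a b, le_bot_iff.1 (ha ▸ hW (min_le_left _ _)), le_bot_iff.1 (hb ▸ hW' (min_le_right _ _))⟩

theorem exists_monotone_eq_top {W : ℤ → Submodule R V} {W' : ℤ → Submodule R V'} (hW : Monotone W)
    (hW' : Monotone W') (h : ∃ k, W k = ⊤) (h' : ∃ k, W' k = ⊤) : ∃ k, W k = ⊤ ∧ W' k = ⊤ := by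
  obtain ⟨a, ha⟩ := h
  obtain ⟨b, hb⟩ := h'
  exact ⟨max a b, top_le_iff.1 (ha ▸ hW (le_max_left _ _)), top_le_iff.1 (hb ▸ hW' (le_max_right _ _))⟩

theorem exists_antitone_eq_bot {W : ℤ → Submodule R V} {W' : ℤ → Submodule R V'} (hW : Antitone W)
    (hW' : Antitone W') (h : ∃ k, W k = ⊥) (h' : ∃ k, W' k = ⊥) : ∃ k, W k = ⊥ ∧ W' k = ⊥ := by
  obtain ⟨a, ha⟩ := h
  obtain ⟨b, hb⟩ := h'
  exact ⟨max a b, le_bot_iff.1 (ha ▸ hW (le_max_left _ _)), le_bot_iff.1 (hb ▸ hW' (le_max_right _ _))⟩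

theorem exists_antitone_eq_top {W : ℤ → Submodule R V} {W' : ℤ → Submodule R V'} (hW : Antitone W)
    (hW' : Antitone W') (h : ∃ k, W k = ⊤) (h' : ∃ k, W' k = ⊤) : ∃ k, W k = ⊤ ∧ W' k = ⊤ := by
  obtain ⟨a, ha⟩ := h
  obtain ⟨b, hb⟩ := h'
  exact ⟨min a b, top_le_iff.1 (ha ▸ hW (min_le_left _ _)), top_le_iff.1 (hb ▸ hW' (min_le_right _ _))⟩

/-- The product filtrations on a direct sum, given by its two projections. -/
theorem IsMixed.prod (h : IsMixed W F G) (h' : IsMixed W' F' G') {f : U →ₗ[R] V} {f' : U →ₗ[R] V'}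
    (hinj : f.ker ⊓ f'.ker = ⊥) (hsurj : ∀ a b, ∃ x, f x = a ∧ f' x = b) :
    IsMixed (fun k => (W k).comap f ⊓ (W' k).comap f') (fun k => (F k).comap f ⊓ (F' k).comap f')
      (fun k => (G k).comap f ⊓ (G' k).comap f') where
  W_mono _ _ hkl := inf_le_inf (Submodule.comap_mono (h.W_mono hkl))
    (Submodule.comap_mono (h'.W_mono hkl))
  W_bot := (exists_monotone_eq_bot h.W_mono h'.W_mono h.W_bot h'.W_bot).imp fun k hk => by
    rw [hk.1, hk.2]; exact hinj
  W_top := (exists_monotone_eq_top h.W_mono h'.W_mono h.W_top h'.W_top).imp fun k hk => by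
    simp [hk]
  F_anti _ _ hkl := inf_le_inf (Submodule.comap_mono (h.F_anti hkl))
    (Submodule.comap_mono (h'.F_anti hkl))
  F_bot := (exists_antitone_eq_bot h.F_anti h'.F_anti h.F_bot h'.F_bot).imp fun k hk => by
    rw [hk.1, hk.2]; exact hinj
  F_top := (exists_antitone_eq_top h.F_anti h'.F_anti h.F_top h'.F_top).imp fun k hk => by
    simp [hk]
  G_anti _ _ hkl := inf_le_inf (Submodule.comap_mono (h.G_anti hkl))
    (Submodule.comap_mono (h'.G_anti hkl))
  G_bot := (exists_antitone_eq_bot h.G_anti h'.G_anti h.G_bot h'.G_bot).imp fun k hk => by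
    rw [hk.1, hk.2]; exact hinj
  G_top := (exists_antitone_eq_top h.G_anti h'.G_anti h.G_top h'.G_top).imp fun k hk => by
    simp [hk]
  decomp k p q hpq z hz := by
    obtain ⟨x, hx, y, hy, hw⟩ := h.decomp k p q hpq (f z) hz.1
    obtain ⟨x', hx', y', hy', hw'⟩ := h'.decomp k p q hpq (f' z) hz.2
    obtain ⟨u, rfl, rfl⟩ := hsurj x x'
    obtain ⟨v, rfl, rfl⟩ := hsurj y y'
    exact ⟨u, ⟨⟨hx.1, hx'.1⟩, ⟨hx.2, hx'.2⟩⟩, v, ⟨⟨hy.1, hy'.1⟩, ⟨hy.2, hy'.2⟩⟩,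
      by simpa using hw, by simpa using hw'⟩
  sep k p q hpq := (h.sep k p q hpq).prod (h'.sep k p q hpq)

/-- Separatedness of an extension. -/
theorem Separated.of_exact {W₀ F₀ G₀ : ℤ → Submodule R U} {j : U →ₗ[R] V}
    (h₀ : IsMixed W₀ F₀ G₀) (h : IsMixed W F G) (h' : IsMixed W' F' G')
    (hj : IsFiltered W₀ F₀ G₀ W F G j) (hg : IsFiltered W F G W' F' G' g)
    (hinj : Function.Injective j) (hjg : Function.Exact j g) {k p q : ℤ}
    (hs₀ : Separated W₀ F₀ G₀ k p q) (hs' : Separated W' F' G' k p q) :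
    Separated W F G k p q := by
  intro x hx y hy hxy
  have hgx : g x ∈ W' (k - 1) :=
    hs' _ ⟨hg.map_F _ _ hx.1, hg.map_W _ _ hx.2⟩ (g y) ⟨hg.map_G _ _ hy.1, hg.map_W _ _ hy.2⟩
      (by simpa using hg.map_W _ _ hxy)
  have hgy : g y ∈ W' (k - 1) := by simpa using sub_mem hgx (hg.map_W _ _ hxy)
  have hle : W (k - 1) ≤ W k := h.W_mono (by omega)
  -- Subtracting corrections of weight k - 1 moves x and y into the kernel of g, which is the range
  -- of j.
  obtain ⟨x', hx', ex⟩ := h.strict h' hg (k := k - 1) ⟨hg.map_F _ _ hx.1, hgx⟩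
  obtain ⟨y', hy', ey⟩ := h.swap.strict h'.swap hg.swap (k := k - 1) ⟨hg.map_G _ _ hy.1, hgy⟩
  obtain ⟨u, hu⟩ := (hjg (x - x')).1 (by simp [ex])
  obtain ⟨v, hv⟩ := (hjg (y - y')).1 (by simp [ey])
  -- Strictness of the injection j says that the filtrations of U are induced from V, so the
  -- hypothesis on U applies to the preimages.
  obtain ⟨u', hu', eu⟩ := h₀.strict h hj (x := u) (k := k)
    (hu ▸ sub_mem hx ⟨hx'.1, hle hx'.2⟩)
  obtain ⟨v', hv', ev⟩ := h₀.swap.strict h.swap hj.swap (x := v) (k := k)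
    (hv ▸ sub_mem hy ⟨hy'.1, hle hy'.2⟩)
  obtain ⟨w, hw, ew⟩ := h₀.strict_W h hj (x := u' - v') (k := k - 1) (by
    have : j (u' - v') = (x - y) - (x' - y') := by rw [map_sub, eu, ev, hu, hv]; abel
    rw [this]
    exact sub_mem hxy (sub_mem hx'.2 hy'.2))
  have := hs₀ u' hu' v' hv' (hinj ew ▸ hw)
  have h1 := hj.map_W _ _ this
  rw [eu, hu] at h1
  simpa using add_mem h1 hx'.2

end Opposed

/-! ### Rational subspaces of a complexification -/

section Complexify

variable {H H' : Type} [AddCommGroup H] [AddCommGroup H']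

/-- The map `ℂ ⊗ H → ℚ ⊗ H` induced by a rational functional on `ℂ`. -/
def coordMap (H : Type) [AddCommGroup H] (l : ℂ →ₗ[ℚ] ℚ) : ℂ ⊗[ℤ] H →ₗ[ℤ] ℚ ⊗[ℤ] H :=
  LinearMap.rTensor H (l.restrictScalars ℤ)

@[simp]
theorem coordMap_tmul (l : ℂ →ₗ[ℚ] ℚ) (z : ℂ) (h : H) : coordMap H l (z ⊗ₜ h) = l z ⊗ₜ h := rfl

@[simp]
theorem ratToComplex_tmul (z : ℚ) (h : H) : ratToComplex H (z ⊗ₜ h) = (z : ℂ) ⊗ₜ h := rfl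

@[simp]
theorem conjC_tmul (z : ℂ) (h : H) : conjC H (z ⊗ₜ h) = starRingEnd ℂ z ⊗ₜ h := rfl

theorem coordMap_smul_ratToComplex (l : ℂ →ₗ[ℚ] ℚ) (z : ℂ) (x : ℚ ⊗[ℤ] H) :
    coordMap H l (z • ratToComplex H x) = l z • x := by
  induction x with
  | zero => simp
  | tmul q h =>
    have : z * (q : ℂ) = q • z := by rw [mul_comm, Rat.smul_def]
    simp [TensorProduct.smul_tmul', this, mul_comm]
  | add x y hx hy => simp only [map_add, smul_add, hx, hy]

theorem coordMap_baseChange (l : ℂ →ₗ[ℚ] ℚ) (f : H →ₗ[ℤ] H') (x : ℂ ⊗[ℤ] H) :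
    coordMap H' l (f.baseChange ℂ x) = f.baseChange ℚ (coordMap H l x) := by
  induction x with
  | zero => simp
  | tmul z h => simp
  | add x y hx hy => simp only [map_add, hx, hy]

theorem ratToComplex_baseChange (f : H →ₗ[ℤ] H') (x : ℚ ⊗[ℤ] H) :
    ratToComplex H' (f.baseChange ℚ x) = f.baseChange ℂ (ratToComplex H x) := by
  induction x with
  | zero => simp
  | tmul z h => simp
  | add x y hx hy => simp only [map_add, hx, hy]

theorem conjC_baseChange (f : H →ₗ[ℤ] H') (x : ℂ ⊗[ℤ] H) :
    conjC H' (f.baseChange ℂ x) = f.baseChange ℂ (conjC H x) := by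
  induction x with
  | zero => simp
  | tmul z h => simp
  | add x y hx hy => simp only [map_add, hx, hy]

@[simp]
theorem conjC_conjC (x : ℂ ⊗[ℤ] H) : conjC H (conjC H x) = x := by
  induction x with
  | zero => simp
  | tmul z h => simp
  | add x y hx hy => simp only [map_add, hx, hy]

/-- Expansion in a ℚ-basis of ℂ. It is stated for every larger finite index set so that two elements
can be expanded over a common one. -/
theorem exists_eq_sum_smul_ratToComplex {ι : Type*} (b : Module.Basis ι ℚ ℂ) (x : ℂ ⊗[ℤ] H) :
    ∃ s : Finset ι, ∀ t, s ⊆ t → x = ∑ i ∈ t, b i • ratToComplex H (coordMap H (b.coord i) x) := by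
  classical
  induction x with
  | zero => exact ⟨∅, fun t _ => by simp⟩
  | tmul z h =>
    refine ⟨(b.repr z).support, fun t ht => ?_⟩
    simp only [coordMap_tmul, ratToComplex_tmul, TensorProduct.smul_tmul', ← TensorProduct.sum_tmul]
    congr 1
    conv_lhs => rw [← b.linearCombination_repr z]
    rw [Finsupp.linearCombination_apply, Finsupp.sum_of_support_subset _ ht _ (by simp)]
    refine Finset.sum_congr rfl fun i _ => ?_
    rw [Rat.smul_def, smul_eq_mul, mul_comm, b.coord_apply]
  | add x y hx hy =>
    obtain ⟨s, hs⟩ := hx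
    obtain ⟨s', hs'⟩ := hy
    refine ⟨s ∪ s', fun t ht => ?_⟩
    simp only [map_add, smul_add, Finset.sum_add_distrib]
    rw [← hs t (Finset.union_subset_left ht), ← hs' t (Finset.union_subset_right ht)]

/-- Testing on rational coordinates makes it immediate that complexification commutes with
intersections and preimages. -/
theorem mem_complexify_iff {S : Submodule ℚ (ℚ ⊗[ℤ] H)} {x : ℂ ⊗[ℤ] H} :
    x ∈ complexify S ↔ ∀ l, coordMap H l x ∈ S := by
  constructor
  · intro hx l
    induction hx using Submodule.closure_induction with
    | zero => simp
    | add x y _ _ hx hy => rw [map_add]; exact add_mem hx hy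
    | smul_mem c x hx =>
      obtain ⟨y, hy, rfl⟩ := hx
      rw [coordMap_smul_ratToComplex]
      exact S.smul_mem _ hy
  · intro h
    obtain ⟨s, hs⟩ := exists_eq_sum_smul_ratToComplex (Module.Basis.ofVectorSpace ℚ ℂ) x
    rw [hs s subset_rfl]
    exact sum_mem fun i _ => Submodule.smul_mem _ _ (Submodule.subset_span ⟨_, h _, rfl⟩)

theorem ratToComplex_mem_complexify {S : Submodule ℚ (ℚ ⊗[ℤ] H)} {x : ℚ ⊗[ℤ] H} :
    ratToComplex H x ∈ complexify S ↔ x ∈ S := by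
  refine ⟨fun h => ?_, fun h => Submodule.subset_span ⟨x, h, rfl⟩⟩
  -- A ℚ-linear retraction of ℂ onto ℚ recovers x from its image.
  obtain ⟨l, hl⟩ : ∃ l : ℂ →ₗ[ℚ] ℚ, l ∘ₗ (Algebra.linearMap ℚ ℂ) = LinearMap.id :=
    LinearMap.exists_leftInverse_of_injective _
      (LinearMap.ker_eq_bot.2 (algebraMap ℚ ℂ).injective)
  have h1 : l 1 = 1 := by simpa using LinearMap.congr_fun hl 1
  have := mem_complexify_iff.1 h l
  rwa [← one_smul ℂ (ratToComplex H x), coordMap_smul_ratToComplex, h1, one_smul] at this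

theorem complexify_le_iff {S T : Submodule ℚ (ℚ ⊗[ℤ] H)} :
    complexify S ≤ complexify T ↔ S ≤ T :=
  ⟨fun h _ hx => ratToComplex_mem_complexify.1 (h (ratToComplex_mem_complexify.2 hx)),
    fun h => Submodule.span_mono (Set.image_mono h)⟩

@[simp]
theorem complexify_bot : complexify (⊥ : Submodule ℚ (ℚ ⊗[ℤ] H)) = ⊥ := by
  simp [complexify]

@[simp]
theorem complexify_top : complexify (⊤ : Submodule ℚ (ℚ ⊗[ℤ] H)) = ⊤ :=
  top_le_iff.1 fun _ _ => mem_complexify_iff.2 fun _ => trivial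

theorem complexify_inj {S T : Submodule ℚ (ℚ ⊗[ℤ] H)} :
    complexify S = complexify T ↔ S = T := by
  simp only [le_antisymm_iff, complexify_le_iff]

theorem complexify_inf (S T : Submodule ℚ (ℚ ⊗[ℤ] H)) :
    complexify (S ⊓ T) = complexify S ⊓ complexify T := by
  ext x
  simp [mem_complexify_iff, forall_and]

theorem complexify_comap (f : H →ₗ[ℤ] H') (S : Submodule ℚ (ℚ ⊗[ℤ] H')) :
    complexify (S.comap (f.baseChange ℚ)) = (complexify S).comap (f.baseChange ℂ) := by
  ext x
  simp [mem_complexify_iff, coordMap_baseChange]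

theorem complexify_map (f : H →ₗ[ℤ] H') (S : Submodule ℚ (ℚ ⊗[ℤ] H)) :
    complexify (S.map (f.baseChange ℚ)) = (complexify S).map (f.baseChange ℂ) := by
  rw [complexify, complexify, Submodule.map_span, Submodule.map_coe, Set.image_image, Set.image_image]
  simp only [ratToComplex_baseChange]

theorem conj_comap_comap (f : H →ₗ[ℤ] H') (S : Submodule ℂ (ℂ ⊗[ℤ] H')) :
    (S.comap (f.baseChange ℂ)).comap (conjC H) = (S.comap (conjC H')).comap (f.baseChange ℂ) := by
  ext x
  simp [conjC_baseChange]

/-- Conjugation is an involution, so preimages under it are also images. -/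
theorem conj_comap_map (f : H →ₗ[ℤ] H') (S : Submodule ℂ (ℂ ⊗[ℤ] H)) :
    (S.map (f.baseChange ℂ)).comap (conjC H') = (S.comap (conjC H)).map (f.baseChange ℂ) := by
  ext x
  constructor
  · rintro ⟨y, hy, e⟩
    exact ⟨conjC H y, by simpa using hy, by rw [← conjC_baseChange, e, conjC_conjC]⟩
  · rintro ⟨y, hy, rfl⟩
    exact ⟨conjC H y, hy, (conjC_baseChange _ _).symm⟩

end Complexify

/-! ### Opposed filtrations and mixed Hodge structures -/

theorem grPiece_mkQ_eq_iff {H : Type} [AddCommGroup H] {W : ℤ → Submodule ℂ (ℂ ⊗[ℤ] H)} {k : ℤ}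
    {x y : W k} : ((W (k - 1)).submoduleOf (W k)).mkQ x = ((W (k - 1)).submoduleOf (W k)).mkQ y ↔
      (x - y : ℂ ⊗[ℤ] H) ∈ W (k - 1) := by
  rw [← sub_eq_zero, ← map_sub, Submodule.mkQ_apply, Submodule.Quotient.mk_eq_zero]
  rfl

theorem disjoint_grInduced_iff {H : Type} [AddCommGroup H] {W F G : ℤ → Submodule ℂ (ℂ ⊗[ℤ] H)}
    {k p q : ℤ} : Disjoint (grInduced W k (F p)) (grInduced W k (G q)) ↔ Separated W F G k p q := by
  rw [Submodule.disjoint_def]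
  constructor
  · intro h x hx y hy hxy
    have := h (Submodule.mkQ _ ⟨x, hx.2⟩) ⟨⟨x, hx.2⟩, hx.1, rfl⟩
      ⟨⟨y, hy.2⟩, hy.1, (grPiece_mkQ_eq_iff.2 hxy).symm⟩
    simpa using grPiece_mkQ_eq_iff.1 (this.trans (map_zero _).symm)
  · rintro h _ ⟨x, hx, rfl⟩ ⟨y, hy, e⟩
    have := h x ⟨hx, x.2⟩ y ⟨hy, y.2⟩ (grPiece_mkQ_eq_iff.1 e.symm)
    exact (grPiece_mkQ_eq_iff.2 (by simpa using this)).trans (map_zero _)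

theorem codisjoint_grInduced_iff {H : Type} [AddCommGroup H] {W F G : ℤ → Submodule ℂ (ℂ ⊗[ℤ] H)}
    {k p q : ℤ} : Codisjoint (grInduced W k (F p)) (grInduced W k (G q)) ↔
      ∀ z ∈ W k, ∃ x ∈ F p ⊓ W k, ∃ y ∈ G q ⊓ W k, z - (x + y) ∈ W (k - 1) := by
  rw [codisjoint_iff, Submodule.eq_top_iff']
  constructor
  · intro h z hz
    obtain ⟨_, ⟨x, hx, rfl⟩, _, ⟨y, hy, rfl⟩, e⟩ :=
      Submodule.mem_sup.1 (h (Submodule.mkQ _ ⟨z, hz⟩))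
    rw [← map_add] at e
    exact ⟨x, ⟨hx, x.2⟩, y, ⟨hy, y.2⟩, grPiece_mkQ_eq_iff.1 e.symm⟩
  · intro h z
    obtain ⟨z, rfl⟩ := Submodule.mkQ_surjective _ z
    obtain ⟨x, hx, y, hy, hw⟩ := h z z.2
    refine Submodule.mem_sup.2 ⟨_, ⟨⟨x, hx.2⟩, hx.1, rfl⟩, _, ⟨⟨y, hy.2⟩, hy.1, rfl⟩, ?_⟩
    rw [← map_add]
    exact (grPiece_mkQ_eq_iff.2 hw).symm

namespace MHS

/-- The complexified weight filtration. -/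
def Wc (A : MHS) (k : ℤ) : Submodule ℂ A.HC := complexify (A.W k)

/-- The complex conjugate of the Hodge filtration. -/
def Fbar (A : MHS) (q : ℤ) : Submodule ℂ A.HC := (A.F q).comap (conjC A.H)

theorem isMixed (A : MHS) : IsMixed A.Wc A.F A.Fbar where
  W_mono _ _ h := complexify_le_iff.2 (A.W_mono h)
  W_bot := A.W_bot.imp fun k hk => by simp [Wc, hk]
  W_top := A.W_top.imp fun k hk => by simp [Wc, hk]
  F_anti := A.F_anti
  F_bot := A.F_bot
  F_top := A.F_top
  G_anti _ _ h := Submodule.comap_mono (A.F_anti h)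
  G_bot := A.F_bot.imp fun k hk => by
    rw [Fbar, hk, eq_bot_iff]
    intro x hx
    have : conjC A.H x = 0 := hx
    rw [Submodule.mem_bot, ← conjC_conjC x, this, map_zero]
  G_top := A.F_top.imp fun k hk => by simp [Fbar, hk]
  decomp k p q h := by
    have := (A.opposed k p q h).2
    rw [show (A.F q).comap (conjC A.H) = A.Fbar q from rfl, codisjoint_grInduced_iff] at this
    exact this
  sep k p q h := by
    have := (A.opposed k p q h).1
    rw [show (A.F q).comap (conjC A.H) = A.Fbar q from rfl, disjoint_grInduced_iff] at this
    exact this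

/-- A mixed Hodge structure from opposed filtrations. -/
def ofIsMixed (H : Type) [AddCommGroup H] [Module.Finite ℤ H] (W : ℤ → Submodule ℚ (ℚ ⊗[ℤ] H))
    (F : ℤ → Submodule ℂ (ℂ ⊗[ℤ] H))
    (h : IsMixed (fun k => complexify (W k)) F (fun q => (F q).comap (conjC H))) : MHS where
  H := H
  W := W
  F := F
  W_mono _ _ hkl := complexify_le_iff.1 (h.W_mono hkl)
  W_bot := h.W_bot.imp fun k hk => by rwa [← complexify_bot, complexify_inj] at hk
  W_top := h.W_top.imp fun k hk => by rwa [← complexify_top, complexify_inj] at hk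
  F_anti := h.F_anti
  F_bot := h.F_bot
  F_top := h.F_top
  opposed k p q hpq := by
    have h₁ := disjoint_grInduced_iff.2 (h.sep k p q hpq)
    have h₂ := codisjoint_grInduced_iff (W := fun k => complexify (W k)) (F := F)
      (G := fun q => (F q).comap (conjC H)) |>.2 (h.decomp k p q hpq)
    exact ⟨h₁, h₂⟩

/-- A Hodge component is the intersection of two induced subspaces, so its vanishing is
separatedness at weight p + q. Levels are thus inherited by the same lemmas as opposedness. -/
theorem levelLE_iff {A : MHS} {n : ℕ} : A.LevelLE n ↔ ∀ p q : ℤ,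
    ¬ ((0 ≤ p ∧ p ≤ n) ∧ (0 ≤ q ∧ q ≤ n)) → Separated A.Wc A.F A.Fbar (p + q) p q := by
  refine forall₂_congr fun p q => ?_
  rw [← disjoint_grInduced_iff, disjoint_iff, ← not_imp_not, not_ne_iff]
  rfl

/-! ### Morphisms as filtered maps, and their inverses -/

variable {A B : MHS}

/-- The map on complexifications induced by a morphism. -/
abbrev Hom.fC (g : Hom A B) : A.HC →ₗ[ℂ] B.HC := g.f.baseChange ℂ

theorem Hom.isFiltered (g : Hom A B) : IsFiltered A.Wc A.F A.Fbar B.Wc B.F B.Fbar g.fC where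
  map_W k := by
    have := complexify_le_iff.2 (g.map_W k)
    rwa [complexify_comap] at this
  map_F := g.map_F
  map_G k x hx := by
    change conjC _ (g.fC x) ∈ B.F k
    rw [conjC_baseChange]
    exact g.map_F k hx

theorem Hom.exact_fC {C : MHS} {g : Hom A B} {h : Hom B C} (e : Function.Exact g.f h.f) :
    Function.Exact g.fC h.fC :=
  Module.Flat.lTensor_exact ℂ e

theorem Hom.injective_fC {g : Hom A B} (e : Function.Injective g.f) : Function.Injective g.fC :=
  Module.Flat.lTensor_preserves_injective_linearMap (M := ℂ) g.f e

theorem Hom.surjective_fC {g : Hom A B} (e : Function.Surjective g.f) : Function.Surjective g.fC :=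
  LinearMap.lTensor_surjective ℂ e

/-- The inverse of a bijective morphism of mixed Hodge structures. -/
def Hom.inv (g : Hom A B) (h : Function.Bijective g.f) : Hom B A where
  f := (LinearEquiv.ofBijective g.f h).symm
  map_W k y hy := by
    obtain ⟨x, rfl⟩ := LinearMap.lTensor_surjective ℚ h.2 y
    -- Strictness is available over ℂ; membership in the rational subspace is recovered from
    -- membership in its complexification.
    obtain ⟨x', hx', e⟩ := A.isMixed.strict_W B.isMixed g.isFiltered (k := k)
      (x := ratToComplex _ x)
      (by rw [← ratToComplex_baseChange]; exact ratToComplex_mem_complexify.2 hy)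
    rw [Hom.injective_fC h.1 e] at hx'
    have hsymm : ((LinearEquiv.ofBijective g.f h).symm : B.H →ₗ[ℤ] A.H) ∘ₗ g.f = LinearMap.id :=
      LinearMap.ext fun z => (LinearEquiv.ofBijective g.f h).symm_apply_apply z
    have : ((LinearEquiv.ofBijective g.f h).symm : B.H →ₗ[ℤ] A.H).baseChange ℚ
        (g.f.baseChange ℚ x) = x := by
      rw [← LinearMap.comp_apply, ← LinearMap.baseChange_comp, hsymm]
      simp
    exact (congrArg (· ∈ A.W k) this).mpr (ratToComplex_mem_complexify.1 hx')
  map_F p y hy := by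
    obtain ⟨x, rfl⟩ := Hom.surjective_fC h.2 y
    obtain ⟨x', hx', e⟩ := A.isMixed.strict_F' B.isMixed g.isFiltered hy
    rw [Hom.injective_fC h.1 e] at hx'
    have hsymm : ((LinearEquiv.ofBijective g.f h).symm : B.H →ₗ[ℤ] A.H) ∘ₗ g.f = LinearMap.id :=
      LinearMap.ext fun z => (LinearEquiv.ofBijective g.f h).symm_apply_apply z
    have : ((LinearEquiv.ofBijective g.f h).symm : B.H →ₗ[ℤ] A.H).baseChange ℂ (g.fC x) = x := by
      rw [← LinearMap.comp_apply, ← LinearMap.baseChange_comp, hsymm]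
      simp
    exact (congrArg (· ∈ A.F p) this).mpr hx'

end MHS

namespace MHS

variable {A B C : MHS}

/-! ### Products, kernels and cokernels of mixed Hodge structures -/

instance : Zero (Hom A B) := ⟨⟨0, fun k x _ => by simp, fun p x _ => by simp⟩⟩

instance : Add (Hom A B) := ⟨fun g h => ⟨g.f + h.f,
  fun k x hx => by
    change (g.f + h.f).baseChange ℚ x ∈ B.W k
    rw [LinearMap.baseChange_add]
    exact add_mem (show g.f.baseChange ℚ x ∈ B.W k from g.map_W k hx) (h.map_W k hx),
  fun p x hx => by
    change (g.f + h.f).baseChange ℂ x ∈ B.F p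
    rw [LinearMap.baseChange_add]
    exact add_mem (show g.f.baseChange ℂ x ∈ B.F p from g.map_F p hx) (h.map_F p hx)⟩⟩

instance : Neg (Hom A B) := ⟨fun g => ⟨-g.f,
  fun k x hx => by
    change (-g.f).baseChange ℚ x ∈ B.W k
    rw [LinearMap.baseChange_neg]
    exact neg_mem (show g.f.baseChange ℚ x ∈ B.W k from g.map_W k hx),
  fun p x hx => by
    change (-g.f).baseChange ℂ x ∈ B.F p
    rw [LinearMap.baseChange_neg]
    exact neg_mem (show g.f.baseChange ℂ x ∈ B.F p from g.map_F p hx)⟩⟩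

instance : AddCommGroup (Hom A B) where
  add_assoc _ _ _ := Hom.ext (add_assoc _ _ _)
  zero_add _ := Hom.ext (zero_add _)
  add_zero _ := Hom.ext (add_zero _)
  add_comm _ _ := Hom.ext (add_comm _ _)
  neg_add_cancel _ := Hom.ext (neg_add_cancel _)
  nsmul := nsmulRec
  zsmul := zsmulRec

instance : Preadditive MHS where
  homGroup A B := inferInstanceAs (AddCommGroup (Hom A B))
  add_comp _ _ _ _ _ h := Hom.ext (LinearMap.comp_add _ _ (Hom.f h))
  comp_add _ _ _ g _ _ := Hom.ext (LinearMap.add_comp (Hom.f g) _ _)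

@[simp] theorem add_f (g h : A ⟶ B) : Hom.f (g + h) = Hom.f g + Hom.f h := rfl

@[simp] theorem neg_f (g : A ⟶ B) : Hom.f (-g) = -Hom.f g := rfl

@[simp] theorem sub_f (g h : A ⟶ B) : Hom.f (g - h) = Hom.f g - Hom.f h := by
  rw [sub_eq_add_neg, add_f, neg_f, ← sub_eq_add_neg]

theorem baseChange_baseChange (K : Type) [CommRing K] {M N P : Type} [AddCommGroup M]
    [AddCommGroup N] [AddCommGroup P] (f : M →ₗ[ℤ] N) (g : N →ₗ[ℤ] P) (x : K ⊗[ℤ] M) :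
    g.baseChange K (f.baseChange K x) = (g ∘ₗ f).baseChange K x := by
  rw [LinearMap.baseChange_comp]
  rfl

theorem hom_ext {g h : A ⟶ B} (e : Hom.f g = Hom.f h) : g = h := Hom.ext e

/-- The kernel of a morphism of mixed Hodge structures. -/
def kernel (g : A ⟶ B) : MHS :=
  ofIsMixed (LinearMap.ker (Hom.f g))
    (fun k => (A.W k).comap ((LinearMap.ker (Hom.f g)).subtype.baseChange ℚ))
    (fun p => (A.F p).comap ((LinearMap.ker (Hom.f g)).subtype.baseChange ℂ)) <| by
    simp only [complexify_comap, conj_comap_comap]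
    exact A.isMixed.comap B.isMixed (Hom.isFiltered g)
      (Module.Flat.lTensor_preserves_injective_linearMap _ (Submodule.injective_subtype _))
      (Module.Flat.lTensor_exact ℂ (LinearMap.exact_subtype_ker_map (Hom.f g)))

/-- The inclusion of the kernel. -/
def kernelι (g : A ⟶ B) : kernel g ⟶ A :=
  Hom.mk (LinearMap.ker (Hom.f g)).subtype (fun _ => le_rfl) (fun _ => le_rfl)

theorem kernelι_injective (g : A ⟶ B) : Function.Injective (Hom.f (kernelι g)) :=
  Submodule.injective_subtype _

theorem kernelι_exact (g : A ⟶ B) : Function.Exact (Hom.f (kernelι g)) (Hom.f g) :=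
  LinearMap.exact_subtype_ker_map (Hom.f g)

/-- The group homomorphism underlying `kernelLift`. -/
def kernelLiftMap (g : A ⟶ B) (h : C ⟶ A) (e : h ≫ g = 0) : C.H →ₗ[ℤ] (kernel g).H :=
  (Hom.f h).codRestrict (LinearMap.ker (Hom.f g)) fun x => LinearMap.congr_fun (congrArg Hom.f e) x

/-- The universal property of the kernel. -/
def kernelLift (g : A ⟶ B) (h : C ⟶ A) (e : h ≫ g = 0) : C ⟶ kernel g :=
  Hom.mk (kernelLiftMap g h e)
    (fun k x hx => by
      change (Hom.f (kernelι g)).baseChange ℚ ((kernelLiftMap g h e).baseChange ℚ x) ∈ A.W k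
      rw [baseChange_baseChange]
      exact Hom.map_W h k hx)
    (fun k x hx => by
      change (Hom.f (kernelι g)).baseChange ℂ ((kernelLiftMap g h e).baseChange ℂ x) ∈ A.F k
      rw [baseChange_baseChange]
      exact Hom.map_F h k hx)

theorem kernelLift_ι (g : A ⟶ B) (h : C ⟶ A) (e : h ≫ g = 0) :
    kernelLift g h e ≫ kernelι g = h := rfl

/-- The cokernel of a morphism of mixed Hodge structures. -/
def cokernel (g : A ⟶ B) : MHS :=
  ofIsMixed (B.H ⧸ LinearMap.range (Hom.f g))
    (fun k => (B.W k).map ((LinearMap.range (Hom.f g)).mkQ.baseChange ℚ))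
    (fun p => (B.F p).map ((LinearMap.range (Hom.f g)).mkQ.baseChange ℂ)) <| by
    simp only [complexify_map, conj_comap_map]
    exact A.isMixed.map B.isMixed (Hom.isFiltered g)
      (Module.Flat.lTensor_exact ℂ (LinearMap.exact_map_mkQ_range (Hom.f g)))
      (LinearMap.lTensor_surjective ℂ (Submodule.mkQ_surjective _))

/-- The projection to the cokernel. -/
def cokernelπ (g : A ⟶ B) : B ⟶ cokernel g :=
  Hom.mk (LinearMap.range (Hom.f g)).mkQ (fun _ => Submodule.le_comap_map _ _)
    (fun _ => Submodule.le_comap_map _ _)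

theorem cokernelπ_surjective (g : A ⟶ B) : Function.Surjective (Hom.f (cokernelπ g)) :=
  Submodule.mkQ_surjective _

theorem cokernelπ_exact (g : A ⟶ B) : Function.Exact (Hom.f g) (Hom.f (cokernelπ g)) :=
  LinearMap.exact_map_mkQ_range (Hom.f g)

/-- The group homomorphism underlying `cokernelDesc`. -/
def cokernelDescMap (g : A ⟶ B) (h : B ⟶ C) (e : g ≫ h = 0) : (cokernel g).H →ₗ[ℤ] C.H :=
  (((LinearMap.range (Hom.f g)).liftQ (Hom.f h)
      (LinearMap.range_le_ker_iff.2 (congrArg Hom.f e))).toAddMonoidHom :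
    (B.H ⧸ LinearMap.range (Hom.f g)) →+ C.H).toIntLinearMap

/-- The universal property of the cokernel. -/
def cokernelDesc (g : A ⟶ B) (h : B ⟶ C) (e : g ≫ h = 0) : cokernel g ⟶ C :=
  Hom.mk (cokernelDescMap g h e)
    (fun k => by
      rintro _ ⟨x, hx, rfl⟩
      change (cokernelDescMap g h e).baseChange ℚ ((Hom.f (cokernelπ g)).baseChange ℚ x) ∈ C.W k
      rw [baseChange_baseChange]
      exact Hom.map_W h k hx)
    (fun k => by
      rintro _ ⟨x, hx, rfl⟩
      change (cokernelDescMap g h e).baseChange ℂ ((Hom.f (cokernelπ g)).baseChange ℂ x) ∈ C.F k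
      rw [baseChange_baseChange]
      exact Hom.map_F h k hx)

theorem cokernelπ_desc (g : A ⟶ B) (h : B ⟶ C) (e : g ≫ h = 0) :
    cokernelπ g ≫ cokernelDesc g h e = h := rfl

/-- Used to see that the two projections remain jointly injective after base change. -/
theorem baseChange_inl_fst_add (K : Type) [CommRing K] (M N : Type) [AddCommGroup M]
    [AddCommGroup N] (x : K ⊗[ℤ] (M × N)) :
    (LinearMap.inl ℤ M N).baseChange K ((LinearMap.fst ℤ M N).baseChange K x) +
      (LinearMap.inr ℤ M N).baseChange K ((LinearMap.snd ℤ M N).baseChange K x) = x := by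
  induction x with
  | zero => simp
  | tmul z h => simp [← TensorProduct.tmul_add]
  | add x y hx hy =>
    simp only [map_add]
    rw [add_add_add_comm, hx, hy]

/-- The product of two mixed Hodge structures. -/
def prod (A B : MHS) : MHS :=
  ofIsMixed (A.H × B.H)
    (fun k => (A.W k).comap ((LinearMap.fst ℤ A.H B.H).baseChange ℚ) ⊓
      (B.W k).comap ((LinearMap.snd ℤ A.H B.H).baseChange ℚ))
    (fun k => (A.F k).comap ((LinearMap.fst ℤ A.H B.H).baseChange ℂ) ⊓
      (B.F k).comap ((LinearMap.snd ℤ A.H B.H).baseChange ℂ)) <| by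
    simp only [complexify_inf, complexify_comap, Submodule.comap_inf, conj_comap_comap]
    refine A.isMixed.prod B.isMixed ?_ fun a b => ?_
    · rw [eq_bot_iff]
      rintro x ⟨h₁, h₂⟩
      rw [Submodule.mem_bot, ← baseChange_inl_fst_add ℂ _ _ x, LinearMap.mem_ker.1 h₁,
        LinearMap.mem_ker.1 h₂]
      simp
    · refine ⟨(LinearMap.inl ℤ A.H B.H).baseChange ℂ a + (LinearMap.inr ℤ A.H B.H).baseChange ℂ b,
        ?_, ?_⟩
      · rw [map_add]
        simp only [← LinearMap.comp_apply, ← LinearMap.baseChange_comp]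
        simp
      · rw [map_add]
        simp only [← LinearMap.comp_apply, ← LinearMap.baseChange_comp]
        simp

/-- The first projection. -/
def fst (A B : MHS) : prod A B ⟶ A :=
  Hom.mk (LinearMap.fst ℤ A.H B.H) (fun _ => inf_le_left) (fun _ => inf_le_left)

/-- The second projection. -/
def snd (A B : MHS) : prod A B ⟶ B :=
  Hom.mk (LinearMap.snd ℤ A.H B.H) (fun _ => inf_le_right) (fun _ => inf_le_right)

/-- The first injection. -/
def inl (A B : MHS) : A ⟶ prod A B :=
  Hom.mk (LinearMap.inl ℤ A.H B.H)
    (fun k x hx => ⟨by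
      change (LinearMap.fst ℤ A.H B.H).baseChange ℚ ((LinearMap.inl ℤ A.H B.H).baseChange ℚ x) ∈ A.W k
      rw [baseChange_baseChange, LinearMap.fst_comp_inl]
      simpa using hx,
    by
      change (LinearMap.snd ℤ A.H B.H).baseChange ℚ ((LinearMap.inl ℤ A.H B.H).baseChange ℚ x) ∈ B.W k
      rw [baseChange_baseChange, LinearMap.snd_comp_inl]
      simp⟩)
    (fun k x hx => ⟨by
      change (LinearMap.fst ℤ A.H B.H).baseChange ℂ ((LinearMap.inl ℤ A.H B.H).baseChange ℂ x) ∈ A.F k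
      rw [baseChange_baseChange, LinearMap.fst_comp_inl]
      simpa using hx,
    by
      change (LinearMap.snd ℤ A.H B.H).baseChange ℂ ((LinearMap.inl ℤ A.H B.H).baseChange ℂ x) ∈ B.F k
      rw [baseChange_baseChange, LinearMap.snd_comp_inl]
      simp⟩)

/-- The second injection. -/
def inr (A B : MHS) : B ⟶ prod A B :=
  Hom.mk (LinearMap.inr ℤ A.H B.H)
    (fun k x hx => ⟨by
      change (LinearMap.fst ℤ A.H B.H).baseChange ℚ ((LinearMap.inr ℤ A.H B.H).baseChange ℚ x) ∈ A.W k
      rw [baseChange_baseChange, LinearMap.fst_comp_inr]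
      simp,
    by
      change (LinearMap.snd ℤ A.H B.H).baseChange ℚ ((LinearMap.inr ℤ A.H B.H).baseChange ℚ x) ∈ B.W k
      rw [baseChange_baseChange, LinearMap.snd_comp_inr]
      simpa using hx⟩)
    (fun k x hx => ⟨by
      change (LinearMap.fst ℤ A.H B.H).baseChange ℂ ((LinearMap.inr ℤ A.H B.H).baseChange ℂ x) ∈ A.F k
      rw [baseChange_baseChange, LinearMap.fst_comp_inr]
      simp,
    by
      change (LinearMap.snd ℤ A.H B.H).baseChange ℂ ((LinearMap.inr ℤ A.H B.H).baseChange ℂ x) ∈ B.F k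
      rw [baseChange_baseChange, LinearMap.snd_comp_inr]
      simpa using hx⟩)

/-- The product as a biproduct. -/
def bicone (A B : MHS) : BinaryBicone A B where
  pt := prod A B
  fst := fst A B
  snd := snd A B
  inl := inl A B
  inr := inr A B
  inl_fst := rfl
  inl_snd := rfl
  inr_fst := rfl
  inr_snd := rfl

theorem bicone_total (A B : MHS) :
    (bicone A B).fst ≫ (bicone A B).inl + (bicone A B).snd ≫ (bicone A B).inr = 𝟙 _ :=
  hom_ext <| by
    change LinearMap.inl ℤ A.H B.H ∘ₗ LinearMap.fst ℤ A.H B.H +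
      LinearMap.inr ℤ A.H B.H ∘ₗ LinearMap.snd ℤ A.H B.H = LinearMap.id
    ext <;> simp

/-! ### Levels -/

theorem LevelLE.kernel {n : ℕ} (h : A.LevelLE n) (g : A ⟶ B) : (kernel g).LevelLE n := by
  rw [levelLE_iff] at h ⊢
  intro p q hpq
  have := (h p q hpq).comap (j := (LinearMap.ker (Hom.f g)).subtype.baseChange ℂ)
  simp only [Wc, Fbar, ← complexify_comap, ← conj_comap_comap] at this
  exact this

theorem LevelLE.cokernel {n : ℕ} (h : B.LevelLE n) (g : A ⟶ B) : (cokernel g).LevelLE n := by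
  rw [levelLE_iff] at h ⊢
  intro p q hpq
  have := Separated.map (r := (LinearMap.range (Hom.f g)).mkQ.baseChange ℂ) A.isMixed B.isMixed
    (Hom.isFiltered g)
    (Module.Flat.lTensor_exact ℂ (LinearMap.exact_map_mkQ_range (Hom.f g))) (h p q hpq) (by omega)
  simp only [Wc, Fbar, ← complexify_map, ← conj_comap_map] at this
  exact this

theorem LevelLE.prod {n : ℕ} (h : A.LevelLE n) (h' : B.LevelLE n) : (prod A B).LevelLE n := by
  rw [levelLE_iff] at h h' ⊢
  intro p q hpq
  have := (h p q hpq).prod (f := (LinearMap.fst ℤ A.H B.H).baseChange ℂ)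
    (f' := (LinearMap.snd ℤ A.H B.H).baseChange ℂ) (h' p q hpq)
  simp only [Wc, Fbar, ← complexify_comap, ← complexify_inf, ← conj_comap_comap,
    ← Submodule.comap_inf] at this
  exact this

theorem LevelLE.of_exact {n : ℕ} (hA : A.LevelLE n) (hC : C.LevelLE n) {g : A ⟶ B} {h : B ⟶ C}
    (hg : Function.Injective (Hom.f g)) (e : Function.Exact (Hom.f g) (Hom.f h)) : B.LevelLE n := by
  rw [levelLE_iff] at hA hC ⊢
  exact fun p q hpq => (hA p q hpq).of_exact A.isMixed B.isMixed C.isMixed (Hom.isFiltered g)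
    (Hom.isFiltered h) (Hom.injective_fC hg) (Hom.exact_fC e) (hC p q hpq)

/-! ### Quotients by the Hodge filtration -/

theorem quot_mk (g : A ⟶ B) (p : ℤ) (x : A.HC) :
    Hom.quot g p (Submodule.Quotient.mk x) = Submodule.Quotient.mk (Hom.fC g x) := rfl

theorem proj_quot (g : A ⟶ B) {p q : ℤ} (h : p ≤ q) (x : A.HC ⧸ A.F q) :
    B.proj h (Hom.quot g q x) = Hom.quot g p (A.proj h x) := by
  obtain ⟨y, rfl⟩ := Submodule.Quotient.mk_surjective _ x
  rfl

theorem quot_toQuot (g : A ⟶ B) (p : ℤ) (x : A.H) :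
    Hom.quot g p (A.toQuot p x) = B.toQuot p (Hom.f g x) := by
  change Submodule.Quotient.mk (Hom.fC g ((1 : ℂ) ⊗ₜ[ℤ] x)) = _
  rw [LinearMap.baseChange_tmul]
  rfl

theorem quot_add (g h : A ⟶ B) (p : ℤ) (x : A.HC ⧸ A.F p) :
    Hom.quot (g + h) p x = Hom.quot g p x + Hom.quot h p x := by
  obtain ⟨y, rfl⟩ := Submodule.Quotient.mk_surjective _ x
  simp only [quot_mk, Hom.fC, add_f, LinearMap.baseChange_add]
  rfl

/-- This is strictness for `F`: the Hodge filtration of A is the one induced from B. -/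
theorem quot_injective {g : A ⟶ B} (hg : Function.Injective (Hom.f g)) (p : ℤ) :
    Function.Injective (Hom.quot g p) := by
  rw [injective_iff_map_eq_zero]
  intro x hx
  obtain ⟨y, rfl⟩ := Submodule.Quotient.mk_surjective _ x
  rw [quot_mk, Submodule.Quotient.mk_eq_zero] at hx
  obtain ⟨z, hz, e⟩ := A.isMixed.strict_F' B.isMixed (Hom.isFiltered g) hx
  rw [Submodule.Quotient.mk_eq_zero, ← Hom.injective_fC hg e]
  exact hz

/-- By strictness, a lift whose image lies in `F p` can be changed by an element of `F p` into one
that the next map kills. -/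
theorem quot_exact {g : A ⟶ B} {h : B ⟶ C} (e : Function.Exact (Hom.f g) (Hom.f h)) (p : ℤ) :
    Function.Exact (Hom.quot g p) (Hom.quot h p) := by
  have eC := Hom.exact_fC e
  intro x
  obtain ⟨y, rfl⟩ := Submodule.Quotient.mk_surjective _ x
  constructor
  · intro hy
    rw [quot_mk, Submodule.Quotient.mk_eq_zero] at hy
    obtain ⟨z, hz, ez⟩ := B.isMixed.strict_F' C.isMixed (Hom.isFiltered h) hy
    obtain ⟨a, ha⟩ := (eC (y - z)).1 (by rw [map_sub, ez, sub_self])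
    refine ⟨Submodule.Quotient.mk a, ?_⟩
    rw [quot_mk, ha, Submodule.Quotient.mk_sub, (Submodule.Quotient.mk_eq_zero _).2 hz, sub_zero]
  · rintro ⟨z, hz⟩
    obtain ⟨a, rfl⟩ := Submodule.Quotient.mk_surjective _ z
    rw [← hz, quot_mk, quot_mk, eC.apply_apply_eq_zero]
    rfl

theorem quot_surjective {g : A ⟶ B} (hg : Function.Surjective (Hom.f g)) (p : ℤ) :
    Function.Surjective (Hom.quot g p) := by
  intro x
  obtain ⟨y, rfl⟩ := Submodule.Quotient.mk_surjective _ x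
  obtain ⟨z, rfl⟩ := Hom.surjective_fC hg y
  exact ⟨Submodule.Quotient.mk z, rfl⟩

/-- A bijective morphism of mixed Hodge structures is an isomorphism. -/
def isoOfBijective (g : A ⟶ B) (h : Function.Bijective (Hom.f g)) : A ≅ B where
  hom := g
  inv := Hom.inv g h
  hom_inv_id := hom_ext <| LinearMap.ext fun x =>
    (LinearEquiv.ofBijective (Hom.f g) h).symm_apply_apply x
  inv_hom_id := hom_ext <| LinearMap.ext fun x =>
    (LinearEquiv.ofBijective (Hom.f g) h).apply_symm_apply x

end MHS

/-! ### The group of extensions in a category with enough pushouts and pullbacks -/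

section ExtGroup

variable {C : Type 1} [Category.{0} C] [HasShortExact C] {A A' A'' B : C}

/-- A morphism of extensions over `f` and the identity of `B`. -/
def Extn.Over (f : A ⟶ A') (S : Extn B A) (T : Extn B A') : Prop :=
  ∃ e : S.E ⟶ T.E, S.i ≫ e = f ≫ T.i ∧ e ≫ T.p = S.p

theorem Extn.Over.comp {f : A ⟶ A'} {g : A' ⟶ A''} {S : Extn B A} {T : Extn B A'} {U : Extn B A''} :
    Extn.Over f S T → Extn.Over g T U → Extn.Over (f ≫ g) S U := by
  rintro ⟨e, h₁, h₂⟩ ⟨e', h₁', h₂'⟩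
  exact ⟨e ≫ e', by rw [reassoc_of% h₁, h₁', Category.assoc], by rw [Category.assoc, h₂', h₂]⟩

theorem Extn.over_of_equiv {S T : Extn B A} : S ≈ T → Extn.Over (𝟙 A) S T :=
  fun ⟨e, h₁, h₂⟩ => ⟨e.hom, by rw [h₁, Category.id_comp], h₂⟩

variable (C) in
/-- The properties of short exact sequences on which the Baer sum rests. -/
structure ExtnSums [Preadditive C] where
  bicone : ∀ A B : C, BinaryBicone A B
  total : ∀ A B : C, (bicone A B).fst ≫ (bicone A B).inl + (bicone A B).snd ≫ (bicone A B).inr =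
    𝟙 (bicone A B).pt
  equiv_of_over : ∀ {A B : C} {S T : Extn B A}, Extn.Over (𝟙 A) S T → S ≈ T
  exists_pushout : ∀ {A A' B : C} (f : A ⟶ A') (S : Extn B A), ∃ T : Extn B A', Extn.Over f S T ∧
    ∀ U, Extn.Over f S U → Extn.Over (𝟙 A') T U
  exists_pullback : ∀ {A A' B : C} (S : Extn B A) (T : Extn B A'),
    ∃ (W : Extn B (bicone A A').pt) (q₁ : W.E ⟶ S.E) (q₂ : W.E ⟶ T.E), IsPullback q₁ q₂ S.p T.p ∧
      W.i ≫ q₁ = (bicone A A').fst ≫ S.i ∧ W.i ≫ q₂ = (bicone A A').snd ≫ T.i ∧ q₁ ≫ S.p = W.p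
  nonempty : ∀ A B : C, Nonempty (Extn B A)

namespace ExtnSums

/-! ### The group law, derived from pushouts -/

variable [Preadditive C] (D : ExtnSums C)

include D in
-- The universal pushout maps to both extensions over the identity, and such maps are equivalences.
theorem equiv_of_over_of_over {f : A ⟶ A'} {S : Extn B A} {T T' : Extn B A'}
    (h : Extn.Over f S T) (h' : Extn.Over f S T') : T ≈ T' := by
  obtain ⟨U, _, hU⟩ := D.exists_pushout f S
  exact Setoid.trans (Setoid.symm (D.equiv_of_over (hU T h))) (D.equiv_of_over (hU T' h'))

/-- The pushout of extensions. -/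
def push (f : A ⟶ A') : Ext1 B A → Ext1 B A' :=
  Quotient.map (fun S => (D.exists_pushout f S).choose) fun S T h => by
    refine D.equiv_of_over_of_over (D.exists_pushout f S).choose_spec.1 ?_
    have := (Extn.over_of_equiv h).comp (D.exists_pushout f T).choose_spec.1
    rwa [Category.id_comp] at this

/-- Pushouts can from here on be recognised by a morphism of extensions alone, with no reference to
the chosen construction. -/
theorem push_cls {f : A ⟶ A'} {S : Extn B A} {T : Extn B A'} :
    D.push f S.cls = T.cls ↔ Extn.Over f S T := by
  have h := (D.exists_pushout f S).choose_spec.1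
  constructor
  · intro e
    have := h.comp (Extn.over_of_equiv (Quotient.exact e))
    rwa [Category.comp_id] at this
  · exact fun h' => Quotient.sound (D.equiv_of_over_of_over h h')

theorem push_push (f : A ⟶ A') (g : A' ⟶ A'') (x : Ext1 B A) :
    D.push g (D.push f x) = D.push (f ≫ g) x := by
  obtain ⟨S, rfl⟩ := Quotient.exists_rep x
  obtain ⟨T, hT⟩ := Quotient.exists_rep (D.push f S.cls)
  obtain ⟨U, hU⟩ := Quotient.exists_rep (D.push g T.cls)
  have h₁ := D.push_cls.1 hT.symm
  have h₂ := D.push_cls.1 hU.symm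
  exact ((congrArg (D.push g) hT.symm).trans hU.symm).trans (D.push_cls.2 (h₁.comp h₂)).symm

theorem push_id (x : Ext1 B A) : D.push (𝟙 A) x = x := by
  obtain ⟨S, rfl⟩ := Quotient.exists_rep x
  exact D.push_cls.2 (Extn.over_of_equiv (Setoid.refl S))

theorem over_of_over {S : Extn B A} {T : Extn B A'} {W W' : Extn B (D.bicone A A').pt}
    {q₁ : W.E ⟶ S.E} {q₂ : W.E ⟶ T.E} (h : IsPullback q₁ q₂ S.p T.p)
    (h₁ : W.i ≫ q₁ = (D.bicone A A').fst ≫ S.i) (h₂ : W.i ≫ q₂ = (D.bicone A A').snd ≫ T.i)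
    (hp : q₁ ≫ S.p = W.p) (hS : Extn.Over (D.bicone A A').fst W' S)
    (hT : Extn.Over (D.bicone A A').snd W' T) : Extn.Over (𝟙 _) W' W := by
  obtain ⟨e₁, he₁, hp₁⟩ := hS
  obtain ⟨e₂, he₂, hp₂⟩ := hT
  refine ⟨h.lift e₁ e₂ (hp₁.trans hp₂.symm), h.hom_ext ?_ ?_, ?_⟩
  · rw [Category.assoc, h.lift_fst, he₁, Category.id_comp, h₁]
  · rw [Category.assoc, h.lift_snd, he₂, Category.id_comp, h₂]
  · rw [← hp, h.lift_fst_assoc, hp₁]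

/-- The fibre product over B gives existence, and its universal property uniqueness. -/
theorem existsUnique_pair (x : Ext1 B A) (y : Ext1 B A') : ∃! w : Ext1 B (D.bicone A A').pt,
    D.push (D.bicone A A').fst w = x ∧ D.push (D.bicone A A').snd w = y := by
  obtain ⟨S, rfl⟩ := Quotient.exists_rep x
  obtain ⟨T, rfl⟩ := Quotient.exists_rep y
  obtain ⟨W, q₁, q₂, h, h₁, h₂, hp⟩ := D.exists_pullback S T
  refine ⟨W.cls, ⟨D.push_cls.2 ⟨q₁, h₁, hp⟩, D.push_cls.2 ⟨q₂, h₂, h.w.symm.trans hp⟩⟩, ?_⟩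
  rintro w ⟨hS, hT⟩
  obtain ⟨W', rfl⟩ := Quotient.exists_rep w
  exact Quotient.sound (D.equiv_of_over
    (D.over_of_over h h₁ h₂ hp (D.push_cls.1 hS) (D.push_cls.1 hT)))

/-- The class in `Ext¹(B, A ⊕ A')` with given components. -/
def pair (x : Ext1 B A) (y : Ext1 B A') : Ext1 B (D.bicone A A').pt :=
  (D.existsUnique_pair x y).choose

@[simp]
theorem push_fst_pair (x : Ext1 B A) (y : Ext1 B A') :
    D.push (D.bicone A A').fst (D.pair x y) = x :=
  (D.existsUnique_pair x y).choose_spec.1.1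

@[simp]
theorem push_snd_pair (x : Ext1 B A) (y : Ext1 B A') :
    D.push (D.bicone A A').snd (D.pair x y) = y :=
  (D.existsUnique_pair x y).choose_spec.1.2

theorem eq_pair {x : Ext1 B A} {y : Ext1 B A'} {w : Ext1 B (D.bicone A A').pt}
    (h₁ : D.push (D.bicone A A').fst w = x) (h₂ : D.push (D.bicone A A').snd w = y) :
    w = D.pair x y :=
  (D.existsUnique_pair x y).choose_spec.2 _ ⟨h₁, h₂⟩

/-- The sum of two classes of extensions. -/
def add (x y : Ext1 B A) : Ext1 B A :=
  D.push ((D.bicone A A).fst + (D.bicone A A).snd) (D.pair x y)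

/-- The class with components `push f w` and `push g w` is the pushout of w along (f, g), and the
sum map takes (f, g) to f + g. The group axioms follow from this formula. -/
theorem add_push (f g : A ⟶ A') (w : Ext1 B A) :
    D.add (D.push f w) (D.push g w) = D.push (f + g) w := by
  have h : D.push (f ≫ (D.bicone A' A').inl + g ≫ (D.bicone A' A').inr) w =
      D.pair (D.push f w) (D.push g w) := by
    apply D.eq_pair <;> rw [push_push] <;> simp
  rw [add, ← h, push_push]
  simp

/-- The class of the split extension. -/
def zero (A B : C) : Ext1 B A :=
  D.push (0 : A ⟶ A) (Classical.choice (D.nonempty A B)).cls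

/-- Both x and the chosen class are pushouts of one pair, and either projection followed by zero is
the zero morphism. -/
theorem push_zero (x : Ext1 B A) : D.push (0 : A ⟶ A) x = D.zero A B := by
  have h₁ := D.push_push (D.bicone A A).fst (0 : A ⟶ A)
    (D.pair (Classical.choice (D.nonempty A B)).cls x)
  have h₂ := D.push_push (D.bicone A A).snd (0 : A ⟶ A)
    (D.pair (Classical.choice (D.nonempty A B)).cls x)
  rw [push_fst_pair] at h₁
  rw [push_snd_pair] at h₂
  rw [zero, h₁, h₂, comp_zero, comp_zero]

/-- Both classes are pushouts of their pair along the two projections, so the claim becomes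
commutativity for morphisms. -/
theorem add_comm (x y : Ext1 B A) : D.add x y = D.add y x := by
  have hx := D.push_fst_pair x y
  have hy := D.push_snd_pair x y
  generalize D.pair x y = w at hx hy
  rw [← hx, ← hy, add_push, add_push, _root_.add_comm]

theorem zero_add (x : Ext1 B A) : D.add (D.zero A B) x = x := by
  rw [← D.push_zero x]
  nth_rw 2 [← D.push_id x]
  rw [add_push, _root_.zero_add, push_id]

theorem neg_add_cancel (x : Ext1 B A) : D.add (D.push (-𝟙 A) x) x = D.zero A B := by
  nth_rw 2 [← D.push_id x]
  rw [add_push, _root_.neg_add_cancel, push_zero]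

theorem add_assoc (x y z : Ext1 B A) : D.add (D.add x y) z = D.add x (D.add y z) := by
  set w := D.pair x (D.pair y z) with hw
  have hx : x = D.push (D.bicone A _).fst w := by simp [hw]
  have hy : y = D.push ((D.bicone A _).snd ≫ (D.bicone A A).fst) w := by
    simp [hw, ← push_push]
  have hz : z = D.push ((D.bicone A _).snd ≫ (D.bicone A A).snd) w := by
    simp [hw, ← push_push]
  clear_value w
  rw [hx, hy, hz]
  simp only [add_push, _root_.add_assoc]

/-- The Baer sum makes `Ext¹` an abelian group. -/
@[reducible]
def addCommGroup (A B : C) : AddCommGroup (Ext1 B A) :=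
  letI : Add (Ext1 B A) := ⟨D.add⟩
  letI : Zero (Ext1 B A) := ⟨D.zero A B⟩
  letI : Neg (Ext1 B A) := ⟨D.push (-𝟙 A)⟩
  { add_assoc := D.add_assoc
    zero_add := D.zero_add
    add_zero := fun x => (D.add_comm _ _).trans (D.zero_add x)
    add_comm := D.add_comm
    neg_add_cancel := D.neg_add_cancel
    nsmul := nsmulRec
    zsmul := zsmulRec }

/-- Only morphisms of extensions occur on the right, so the criterion can be transported along a
functor. -/
theorem add_cls_eq_iff {S T U : Extn B A} : D.add S.cls T.cls = U.cls ↔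
    ∃ W : Extn B (D.bicone A A).pt, Extn.Over (D.bicone A A).fst W S ∧
      Extn.Over (D.bicone A A).snd W T ∧
      Extn.Over ((D.bicone A A).fst + (D.bicone A A).snd) W U := by
  constructor
  · intro h
    obtain ⟨W, hW⟩ := Quotient.exists_rep (D.pair S.cls T.cls)
    change W.cls = _ at hW
    rw [add, ← hW, push_cls] at h
    refine ⟨W, ?_, ?_, h⟩ <;> rw [← D.push_cls, hW] <;> simp
  · rintro ⟨W, hS, hT, hU⟩
    rw [← D.push_cls] at hS hT hU
    rw [← hS, ← hT, ← hU, add_push]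

theorem isBaerSum_iff {S T U : Extn B A} : Extn.IsBaerSum S T U ↔ D.add S.cls T.cls = U.cls := by
  rw [add_cls_eq_iff]
  obtain ⟨W, q₁, q₂, h, h₁, h₂, hp⟩ := D.exists_pullback S T
  constructor
  · rintro ⟨P, r₁, r₂, j₁, j₂, s, hP, ⟨h₁₁, h₁₂⟩, ⟨h₂₁, h₂₂⟩, hs₁, hs₂, hs⟩
    -- P is only known to be a fibre product; the comparison map from the extension W supplies the
    -- inclusion of A ⊕ A that P lacks.
    refine ⟨W, ⟨q₁, h₁, hp⟩, ⟨q₂, h₂, h.w.symm.trans hp⟩, hP.lift q₁ q₂ h.w ≫ s, ?_, ?_⟩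
    · have : W.i ≫ hP.lift q₁ q₂ h.w = (D.bicone A A).fst ≫ j₁ + (D.bicone A A).snd ≫ j₂ := by
        apply hP.hom_ext
        · simp [h₁, h₁₁, h₂₁]
        · simp [h₂, h₁₂, h₂₂]
      rw [reassoc_of% this]
      simp [hs₁, hs₂]
    · rw [Category.assoc, hs, hP.lift_fst_assoc, hp]
  · rintro ⟨W', hS, hT, hU⟩
    obtain ⟨s, hs, hsp⟩ : Extn.Over ((D.bicone A A).fst + (D.bicone A A).snd) W U := by
      have h' := D.equiv_of_over (D.over_of_over h h₁ h₂ hp hS hT)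
      have := (Extn.over_of_equiv (Setoid.symm h')).comp hU
      rwa [Category.id_comp] at this
    refine ⟨W.E, q₁, q₂, (D.bicone A A).inl ≫ W.i, (D.bicone A A).inr ≫ W.i, s, h, ?_, ?_, ?_, ?_,
      by rw [hsp, hp]⟩
    · simp [h₁, h₂]
    · simp [h₁, h₂]
    · simp [hs]
    · simp [hs]

end ExtnSums

end ExtGroup

/-! ### Products, kernels and cokernels of formal Hodge structures -/

namespace MHS

variable {A B : MHS}

theorem quot_neg (g : A ⟶ B) (p : ℤ) (x : A.HC ⧸ A.F p) :
    Hom.quot (-g) p x = -Hom.quot g p x := by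
  rw [eq_neg_iff_add_eq_zero, ← quot_add, neg_add_cancel, FHS.quot_zero]

theorem quot_quot {C : MHS} {g : A ⟶ B} {h : B ⟶ C} {k : A ⟶ C} (e : g ≫ h = k) (p : ℤ)
    (x : A.HC ⧸ A.F p) : Hom.quot h p (Hom.quot g p x) = Hom.quot k p x := by
  rw [← e, FHS.quot_comp]

theorem quot_fst_add (p : ℤ) (a : A.HC ⧸ A.F p) (b : B.HC ⧸ B.F p) :
    Hom.quot (fst A B) p (Hom.quot (inl A B) p a + Hom.quot (inr A B) p b) = a := by
  rw [map_add, quot_quot (show inl A B ≫ fst A B = 𝟙 _ from rfl), quot_quot (show inr A B ≫ fst A B = 0 from rfl), FHS.quot_id,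
    FHS.quot_zero, add_zero]

theorem quot_snd_add (p : ℤ) (a : A.HC ⧸ A.F p) (b : B.HC ⧸ B.F p) :
    Hom.quot (snd A B) p (Hom.quot (inl A B) p a + Hom.quot (inr A B) p b) = b := by
  rw [map_add, quot_quot (show inl A B ≫ snd A B = 0 from rfl), quot_quot (show inr A B ≫ snd A B = 𝟙 _ from rfl), FHS.quot_id,
    FHS.quot_zero, zero_add]

/-- Lifting a map to `A_ℂ / F^p` along the inclusion of the kernel of a morphism. -/
def kernelQuotLift {V : Type} [AddCommGroup V] [Module ℂ V] (g : A ⟶ B) (p : ℤ)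
    (f : V →ₗ[ℂ] A.HC ⧸ A.F p) (hf : ∀ x, Hom.quot g p (f x) = 0) :
    V →ₗ[ℂ] (kernel g).HC ⧸ (kernel g).F p :=
  (LinearEquiv.ofInjective _ (quot_injective (kernelι_injective g) p)).symm.toLinearMap ∘ₗ
    f.codRestrict _ fun x => (quot_exact (kernelι_exact g) p _).1 (hf x)

theorem quot_kernelQuotLift {V : Type} [AddCommGroup V] [Module ℂ V] (g : A ⟶ B) (p : ℤ)
    (f : V →ₗ[ℂ] A.HC ⧸ A.F p) (hf : ∀ x, Hom.quot g p (f x) = 0) (x : V) :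
    Hom.quot (kernelι g) p (kernelQuotLift g p f hf x) = f x :=
  congrArg Subtype.val ((LinearEquiv.ofInjective _
    (quot_injective (kernelι_injective g) p)).apply_symm_apply _)

end MHS

namespace FHS

variable {m : ℕ} {X Y Z : FHS m}

instance : Zero (Hom X Y) := ⟨⟨0, 0, fun _ => 0, fun _ _ => by simp,
    fun i x => by rw [quot_zero]; simp,
    fun x => (Y.het.map_zero).symm, fun x => by simp⟩⟩

instance : Add (Hom X Y) := ⟨fun g h => ⟨g.et + h.et, g.o + h.o, fun i => g.φ i + h.φ i,
  fun i x => by simp [g.φ_v, h.φ_v],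
  fun i x => by simp [g.φ_π, h.φ_π, MHS.quot_add],
  fun x => by simp [g.φ_het, h.φ_het],
  fun x => by simp [g.φ_ho, h.φ_ho]⟩⟩

instance : Neg (Hom X Y) := ⟨fun g => ⟨-g.et, -g.o, fun i => -g.φ i,
  fun i x => by simp [g.φ_v],
  fun i x => by simp [g.φ_π, MHS.quot_neg],
  fun x => by simp [g.φ_het],
  fun x => by simp [g.φ_ho]⟩⟩

instance : AddCommGroup (Hom X Y) where
  add_assoc _ _ _ := Hom.ext (add_assoc _ _ _) (add_assoc _ _ _) (add_assoc _ _ _)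
  zero_add _ := Hom.ext (zero_add _) (zero_add _) (zero_add _)
  add_zero _ := Hom.ext (add_zero _) (add_zero _) (add_zero _)
  add_comm _ _ := Hom.ext (add_comm _ _) (add_comm _ _) (add_comm _ _)
  neg_add_cancel _ := Hom.ext (neg_add_cancel _) (neg_add_cancel _) (neg_add_cancel _)
  nsmul := nsmulRec
  zsmul := zsmulRec

instance : Preadditive (FHS m) where
  homGroup X Y := inferInstanceAs (AddCommGroup (Hom X Y))
  add_comp _ _ _ _ _ _ := Hom.ext (Preadditive.add_comp _ _ _ _ _ _) (LinearMap.comp_add _ _ _)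
    (funext fun _ => LinearMap.comp_add _ _ _)
  comp_add _ _ _ _ _ _ := Hom.ext (Preadditive.comp_add _ _ _ _ _ _) (LinearMap.add_comp _ _ _)
    (funext fun _ => LinearMap.add_comp _ _ _)

@[simp] theorem add_et (g h : X ⟶ Y) : Hom.et (g + h) = Hom.et g + Hom.et h := rfl

@[simp] theorem add_o (g h : X ⟶ Y) : Hom.o (g + h) = Hom.o g + Hom.o h := rfl

@[simp] theorem add_φ (g h : X ⟶ Y) (i) : Hom.φ (g + h) i = Hom.φ g i + Hom.φ h i := rfl

@[simp] theorem neg_et (g : X ⟶ Y) : Hom.et (-g) = -Hom.et g := rfl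

@[simp] theorem neg_o (g : X ⟶ Y) : Hom.o (-g) = -Hom.o g := rfl

@[simp] theorem neg_φ (g : X ⟶ Y) (i) : Hom.φ (-g) i = -Hom.φ g i := rfl

@[simp] theorem sub_o (g h : X ⟶ Y) : Hom.o (g - h) = Hom.o g - Hom.o h := by
  rw [sub_eq_add_neg, add_o, neg_o, ← sub_eq_add_neg]

@[simp] theorem sub_φ (g h : X ⟶ Y) (i) : Hom.φ (g - h) i = Hom.φ g i - Hom.φ h i := by
  rw [sub_eq_add_neg, add_φ, neg_φ, ← sub_eq_add_neg]

theorem hom_ext {g h : X ⟶ Y} (e₁ : Hom.et g = Hom.et h) (e₂ : Hom.o g = Hom.o h)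
    (e₃ : ∀ i, Hom.φ g i = Hom.φ h i) : g = h := Hom.ext e₁ e₂ (funext e₃)

/-- The product of two formal Hodge structures. -/
def prod (X Y : FHS m) : FHS m where
  et := MHS.prod X.et Y.et
  level := X.level.prod Y.level
  Ho := X.Ho × Y.Ho
  V i := X.V i × Y.V i
  v i := (X.v i).prodMap (Y.v i)
  π i := (MHS.Hom.quot (MHS.inl X.et Y.et) _ ∘ₗ X.π i).coprod
    (MHS.Hom.quot (MHS.inr X.et Y.et) _ ∘ₗ Y.π i)
  het := X.het.prodMap Y.het
  ho := X.ho.prodMap Y.ho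
  π_v i x := by
    simp only [LinearMap.coprod_apply, LinearMap.prodMap_apply, LinearMap.comp_apply, map_add,
      MHS.proj_quot, X.π_v, Y.π_v]
  π_het x := by
    change MHS.Hom.quot (MHS.inl X.et Y.et) _ (X.π (Fin.last m) (X.het x.1)) +
      MHS.Hom.quot (MHS.inr X.et Y.et) _ (Y.π (Fin.last m) (Y.het x.2)) = _
    rw [X.π_het, Y.π_het, MHS.quot_toQuot, MHS.quot_toQuot, ← map_add]
    congr 1
    exact (LinearMap.congr_fun (LinearMap.coprod_inl_inr (R := ℤ) (M := X.et.H) (M₂ := Y.et.H)) x)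

/-- The first projection. -/
def fst (X Y : FHS m) : prod X Y ⟶ X :=
  Hom.mk (MHS.fst X.et Y.et) (LinearMap.fst ℂ _ _) (fun _ => LinearMap.fst ℂ _ _)
    (fun _ _ => rfl)
    (fun _ _ => (MHS.quot_fst_add _ _ _).symm)
    (fun _ => rfl) (fun _ => rfl)

/-- The second projection. -/
def snd (X Y : FHS m) : prod X Y ⟶ Y :=
  Hom.mk (MHS.snd X.et Y.et) (LinearMap.snd ℂ _ _) (fun _ => LinearMap.snd ℂ _ _)
    (fun _ _ => rfl)
    (fun _ _ => (MHS.quot_snd_add _ _ _).symm)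
    (fun _ => rfl) (fun _ => rfl)

/-- The first injection. -/
def inl (X Y : FHS m) : X ⟶ prod X Y :=
  Hom.mk (MHS.inl X.et Y.et) (LinearMap.inl ℂ _ _) (fun _ => LinearMap.inl ℂ _ _)
    (fun i _ => Prod.ext rfl (map_zero (Y.v i)).symm)
    (fun i x => by
      change MHS.Hom.quot _ _ (X.π i x) + MHS.Hom.quot _ _ (Y.π i 0) = _
      rw [map_zero, map_zero, add_zero]
      rfl)
    (fun x => Prod.ext rfl (map_zero Y.het).symm)
    (fun x => Prod.ext rfl (map_zero Y.ho).symm)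

/-- The second injection. -/
def inr (X Y : FHS m) : Y ⟶ prod X Y :=
  Hom.mk (MHS.inr X.et Y.et) (LinearMap.inr ℂ _ _) (fun _ => LinearMap.inr ℂ _ _)
    (fun i _ => Prod.ext (map_zero (X.v i)).symm rfl)
    (fun i x => by
      change MHS.Hom.quot _ _ (X.π i 0) + MHS.Hom.quot _ _ (Y.π i x) = _
      rw [map_zero, map_zero, zero_add]
      rfl)
    (fun x => Prod.ext (map_zero X.het).symm rfl)
    (fun x => Prod.ext (map_zero X.ho).symm rfl)

/-- The product as a biproduct. -/
def bicone (X Y : FHS m) : BinaryBicone X Y where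
  pt := prod X Y
  fst := fst X Y
  snd := snd X Y
  inl := inl X Y
  inr := inr X Y
  inl_fst := rfl
  inl_snd := rfl
  inr_fst := rfl
  inr_snd := rfl

theorem bicone_total (X Y : FHS m) :
    (bicone X Y).fst ≫ (bicone X Y).inl + (bicone X Y).snd ≫ (bicone X Y).inr = 𝟙 _ := by
  exact hom_ext (MHS.bicone_total X.et Y.et)
    (LinearMap.ext fun x : X.Ho × Y.Ho => Prod.ext (add_zero x.1) (zero_add x.2))
    fun i => LinearMap.ext fun x : X.V i × Y.V i => Prod.ext (add_zero x.1) (zero_add x.2)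

theorem quot_π_ker (g : X ⟶ Y) (i : Fin (m + 1)) (x : LinearMap.ker (Hom.φ g i)) :
    MHS.Hom.quot (Hom.et g) _ ((X.π i ∘ₗ (LinearMap.ker (Hom.φ g i)).subtype) x) = 0 := by
  rw [LinearMap.comp_apply, ← Hom.φ_π, Submodule.subtype_apply, LinearMap.mem_ker.1 x.2, map_zero]

/-- The kernel of a morphism of formal Hodge structures. -/
def kernel (g : X ⟶ Y) : FHS m where
  et := MHS.kernel (Hom.et g)
  level := X.level.kernel _
  Ho := LinearMap.ker (Hom.o g)
  V i := LinearMap.ker (Hom.φ g i)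
  v i := (X.v i).restrict fun x hx => by
    rw [LinearMap.mem_ker] at hx ⊢
    rw [Hom.φ_v, hx, map_zero]
  π i := MHS.kernelQuotLift (Hom.et g) _ (X.π i ∘ₗ (LinearMap.ker (Hom.φ g i)).subtype)
    (quot_π_ker g i)
  het := AddMonoidHom.mk' (fun x => ⟨X.het (MHS.Hom.f (MHS.kernelι (Hom.et g)) x), by
      rw [LinearMap.mem_ker, Hom.φ_het, (MHS.kernelι_exact (Hom.et g)).apply_apply_eq_zero,
        map_zero]⟩) fun x y => Subtype.ext (by simp)
  ho := X.ho.restrict fun x hx => by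
    rw [LinearMap.mem_ker] at hx ⊢
    rw [Hom.φ_ho, hx, map_zero]
  π_v i x := by
    apply MHS.quot_injective (MHS.kernelι_injective (Hom.et g))
    rw [← MHS.proj_quot, MHS.quot_kernelQuotLift, MHS.quot_kernelQuotLift]
    exact X.π_v i x.1
  π_het x := by
    apply MHS.quot_injective (MHS.kernelι_injective (Hom.et g))
    rw [MHS.quot_toQuot, MHS.quot_kernelQuotLift]
    exact X.π_het _

/-- The inclusion of the kernel. -/
def kernelι (g : X ⟶ Y) : kernel g ⟶ X :=
  Hom.mk (MHS.kernelι (Hom.et g)) (LinearMap.ker (Hom.o g)).subtype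
    (fun i => (LinearMap.ker (Hom.φ g i)).subtype) (fun _ _ => rfl)
    (fun i x => (MHS.quot_kernelQuotLift (Hom.et g) _
      (X.π i ∘ₗ (LinearMap.ker (Hom.φ g i)).subtype) (quot_π_ker g i) x).symm) (fun _ => rfl) (fun _ => rfl)

/-- The universal property of the kernel. -/
def kernelLift (g : X ⟶ Y) (h : Z ⟶ X) (e : h ≫ g = 0) : Z ⟶ kernel g :=
  Hom.mk (MHS.kernelLift (Hom.et g) (Hom.et h) (congrArg Hom.et e))
    ((Hom.o h).codRestrict (LinearMap.ker (Hom.o g)) fun x =>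
      LinearMap.congr_fun (congrArg Hom.o e) x)
    (fun i => (Hom.φ h i).codRestrict (LinearMap.ker (Hom.φ g i)) fun x =>
      LinearMap.congr_fun (congrFun (congrArg Hom.φ e) i) x)
    (fun i x => Subtype.ext (Hom.φ_v h i x))
    (fun i x => by
      apply MHS.quot_injective (MHS.kernelι_injective (Hom.et g))
      refine Eq.trans (MHS.quot_kernelQuotLift (Hom.et g) _
        (X.π i ∘ₗ (LinearMap.ker (Hom.φ g i)).subtype) (quot_π_ker g i) _) ?_
      exact (Hom.φ_π h i x).trans (MHS.quot_quot (MHS.kernelLift_ι _ _ _) _ _).symm)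
    (fun x => Subtype.ext (Hom.φ_het h x))
    (fun x => Subtype.ext (Hom.φ_ho h x))

theorem kernelLift_ι (g : X ⟶ Y) (h : Z ⟶ X) (e : h ≫ g = 0) :
    kernelLift g h e ≫ kernelι g = h :=
  hom_ext rfl rfl fun _ => LinearMap.subtype_comp_codRestrict _ _ _

/-- The cokernel of a morphism of formal Hodge structures. -/
def cokernel (g : X ⟶ Y) : FHS m where
  et := MHS.cokernel (Hom.et g)
  level := Y.level.cokernel _
  Ho := Y.Ho ⧸ LinearMap.range (Hom.o g)
  V i := Y.V i ⧸ LinearMap.range (Hom.φ g i)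
  v i := Submodule.mapQ _ _ (Y.v i) <| by
    rintro _ ⟨x, rfl⟩
    exact ⟨X.v i x, Hom.φ_v g i x⟩
  π i := Submodule.liftQ _ (MHS.Hom.quot (MHS.cokernelπ (Hom.et g)) _ ∘ₗ Y.π i) <| by
    rintro _ ⟨x, rfl⟩
    rw [LinearMap.mem_ker, LinearMap.comp_apply, Hom.φ_π]
    exact (MHS.quot_exact (MHS.cokernelπ_exact (Hom.et g)) _).apply_apply_eq_zero _
  het := ((LinearMap.range (MHS.Hom.f (Hom.et g))).liftQ
    ((LinearMap.range (Hom.φ g (Fin.last m))).mkQ.toAddMonoidHom.comp Y.het).toIntLinearMap <| by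
      rintro _ ⟨x, rfl⟩
      rw [LinearMap.mem_ker]
      change (LinearMap.range (Hom.φ g (Fin.last m))).mkQ (Y.het _) = 0
      rw [← Hom.φ_het]
      exact (LinearMap.exact_map_mkQ_range _).apply_apply_eq_zero _).toAddMonoidHom
  ho := Submodule.mapQ _ _ Y.ho <| by
    rintro _ ⟨x, rfl⟩
    exact ⟨X.ho x, Hom.φ_ho g x⟩
  π_v i x := by
    obtain ⟨x, rfl⟩ := Submodule.mkQ_surjective _ x
    change MHS.Hom.quot _ _ (Y.π _ (Y.v i x)) = MHS.proj _ _ (MHS.Hom.quot _ _ (Y.π _ x))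
    rw [MHS.proj_quot, Y.π_v]
  π_het x := by
    obtain ⟨x, rfl⟩ := Submodule.mkQ_surjective _ x
    change MHS.Hom.quot (MHS.cokernelπ (Hom.et g)) _ (Y.π _ (Y.het x)) = _
    rw [Y.π_het, MHS.quot_toQuot]
    rfl

/-- The projection to the cokernel. -/
def cokernelπ (g : X ⟶ Y) : Y ⟶ cokernel g :=
  Hom.mk (MHS.cokernelπ (Hom.et g)) (LinearMap.range (Hom.o g)).mkQ
    (fun i => (LinearMap.range (Hom.φ g i)).mkQ) (fun _ _ => rfl) (fun _ _ => rfl)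
    (fun _ => rfl) (fun _ => rfl)

/-- The universal property of the cokernel. -/
def cokernelDesc (g : X ⟶ Y) (h : Y ⟶ Z) (e : g ≫ h = 0) : cokernel g ⟶ Z :=
  Hom.mk (MHS.cokernelDesc (Hom.et g) (Hom.et h) (congrArg Hom.et e))
    (Submodule.liftQ _ (Hom.o h) (LinearMap.range_le_ker_iff.2 (congrArg Hom.o e)))
    (fun i => Submodule.liftQ _ (Hom.φ h i)
      (LinearMap.range_le_ker_iff.2 (congrFun (congrArg Hom.φ e) i)))
    (fun i x => by
      obtain ⟨x, rfl⟩ := Submodule.mkQ_surjective _ x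
      exact Hom.φ_v h i x)
    (fun i x => by
      obtain ⟨x, rfl⟩ := Submodule.mkQ_surjective _ x
      change Z.π i (Hom.φ h i x) = MHS.Hom.quot _ _ (MHS.Hom.quot _ _ (Y.π i x))
      exact (Hom.φ_π h i x).trans (MHS.quot_quot (MHS.cokernelπ_desc _ _ _) _ _).symm)
    (fun x => by
      obtain ⟨x, rfl⟩ := Submodule.mkQ_surjective _ x
      exact Hom.φ_het h x)
    (fun x => by
      obtain ⟨x, rfl⟩ := Submodule.mkQ_surjective _ x
      exact Hom.φ_ho h x)

theorem cokernelπ_desc (g : X ⟶ Y) (h : Y ⟶ Z) (e : g ≫ h = 0) :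
    cokernelπ g ≫ cokernelDesc g h e = h := hom_ext rfl rfl fun _ => rfl

/-- A componentwise bijective morphism of formal Hodge structures is an isomorphism. -/
def isoOfBijective (g : X ⟶ Y) (h : Function.Bijective (MHS.Hom.f (Hom.et g)))
    (ho : Function.Bijective (Hom.o g)) (hφ : ∀ i, Function.Bijective (Hom.φ g i)) : X ≅ Y where
  hom := g
  inv := Hom.mk (MHS.isoOfBijective (Hom.et g) h).inv
    (LinearEquiv.ofBijective (Hom.o g) ho).symm.toLinearMap
    (fun i => (LinearEquiv.ofBijective (Hom.φ g i) (hφ i)).symm.toLinearMap)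
    (fun i y => by
      obtain ⟨x, rfl⟩ := (hφ _).2 y
      rw [← Hom.φ_v]
      simp)
    (fun i y => by
      obtain ⟨x, rfl⟩ := (hφ _).2 y
      have h₁ := MHS.quot_quot (MHS.isoOfBijective (Hom.et g) h).hom_inv_id _ (X.π i x)
      rw [quot_id] at h₁
      rw [Hom.φ_π]
      exact (congrArg (X.π i) ((LinearEquiv.ofBijective _ (hφ i)).symm_apply_apply x)).trans h₁.symm)
    (fun y => by
      obtain ⟨x, rfl⟩ := h.2 y
      rw [← Hom.φ_het]
      exact ((LinearEquiv.ofBijective _ (hφ _)).symm_apply_apply _).trans (congrArg X.het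
        ((LinearEquiv.ofBijective (MHS.Hom.f (Hom.et g)) h).symm_apply_apply x).symm))
    (fun y => by
      obtain ⟨x, rfl⟩ := ho.2 y
      rw [← Hom.φ_ho]
      simp)
  hom_inv_id := hom_ext (MHS.isoOfBijective (Hom.et g) h).hom_inv_id
    (LinearMap.ext (LinearEquiv.ofBijective (Hom.o g) ho).symm_apply_apply)
    fun i => LinearMap.ext (LinearEquiv.ofBijective (Hom.φ g i) (hφ i)).symm_apply_apply
  inv_hom_id := hom_ext (MHS.isoOfBijective (Hom.et g) h).inv_hom_id
    (LinearMap.ext (LinearEquiv.ofBijective (Hom.o g) ho).apply_symm_apply)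
    fun i => LinearMap.ext (LinearEquiv.ofBijective (Hom.φ g i) (hφ i)).apply_symm_apply

end FHS

/-! ### Short exact sequences of modules -/

section ExactSequences

variable {R A A' E E' B D K Q : Type*} [Ring R] [AddCommGroup A] [Module R A] [AddCommGroup A']
  [Module R A'] [AddCommGroup E] [Module R E] [AddCommGroup E'] [Module R E'] [AddCommGroup B]
  [Module R B] [AddCommGroup D] [Module R D] [AddCommGroup K] [Module R K] [AddCommGroup Q]
  [Module R Q]

/-- Short exactness of a pair of linear maps. -/
def IsShortExact (i : A →ₗ[R] E) (p : E →ₗ[R] B) : Prop :=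
  Function.Injective i ∧ Function.Exact i p ∧ Function.Surjective p

theorem IsShortExact.inl_snd : IsShortExact (LinearMap.inl R A B) (LinearMap.snd R A B) :=
  ⟨LinearMap.inl_injective, Function.Exact.inl_snd, LinearMap.snd_surjective⟩

/-- The short five lemma with identities at both ends. -/
theorem IsShortExact.bijective {i : A →ₗ[R] E} {p : E →ₗ[R] B} {i' : A →ₗ[R] E'}
    {p' : E' →ₗ[R] B} (h : IsShortExact i p) (h' : IsShortExact i' p') {e : E →ₗ[R] E'}
    (hi : e ∘ₗ i = i') (hp : p' ∘ₗ e = p) : Function.Bijective e := by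
  obtain ⟨-, h₂, h₃⟩ := h
  obtain ⟨h₁', h₂', -⟩ := h'
  have hi x : e (i x) = i' x := LinearMap.congr_fun hi x
  have hp x : p' (e x) = p x := LinearMap.congr_fun hp x
  constructor
  · rw [injective_iff_map_eq_zero]
    intro x hx
    obtain ⟨a, rfl⟩ := (h₂ x).1 (by rw [← hp, hx, map_zero])
    rw [hi] at hx
    rw [h₁' (hx.trans (map_zero i').symm), map_zero]
  · intro y
    obtain ⟨x, hx⟩ := h₃ (p' y)
    obtain ⟨a, ha⟩ := (h₂' (y - e x)).1 (by rw [map_sub, hp, hx, sub_self])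
    exact ⟨x + i a, by rw [map_add, hi, ha, add_sub_cancel]⟩

/-- The pushout of a short exact sequence, as a cokernel. -/
theorem IsShortExact.pushout {i : A →ₗ[R] E} {p : E →ₗ[R] B} (h : IsShortExact i p)
    {f : A →ₗ[R] A'} {u : A →ₗ[R] E × A'} {q : E × A' →ₗ[R] Q} (hu : ∀ a, u a = (i a, -f a))
    (huq : Function.Exact u q) (hq : Function.Surjective q) {i' : A' →ₗ[R] Q} {p' : Q →ₗ[R] B}
    (hi' : ∀ a, i' a = q (0, a)) (hp' : ∀ x, p' (q x) = p x.1) : IsShortExact i' p' := by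
  obtain ⟨h₁, h₂, h₃⟩ := h
  refine ⟨?_, fun y => ⟨fun hy => ?_, ?_⟩, fun b => ?_⟩
  · rw [injective_iff_map_eq_zero]
    intro a ha
    rw [hi'] at ha
    obtain ⟨c, hc⟩ := (huq _).1 ha
    rw [hu, Prod.mk.injEq] at hc
    rw [← hc.2, h₁ (hc.1.trans (map_zero i).symm), map_zero, neg_zero]
  · obtain ⟨⟨x, a⟩, rfl⟩ := hq y
    rw [hp'] at hy
    obtain ⟨c, rfl⟩ := (h₂ x).1 hy
    refine ⟨a + f c, ?_⟩
    rw [hi', ← sub_eq_zero, ← map_sub, ← neg_eq_zero, ← map_neg]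
    exact (huq _).2 ⟨c, by simp [hu]⟩
  · rintro ⟨a, rfl⟩
    rw [hi', hp', map_zero]
  · obtain ⟨x, rfl⟩ := h₃ b
    exact ⟨q (x, 0), hp' _⟩

/-- The fibre product of two short exact sequences, as a kernel. -/
theorem IsShortExact.pullback {i : A →ₗ[R] E} {p : E →ₗ[R] B} {i' : A' →ₗ[R] E'} {p' : E' →ₗ[R] B}
    (h : IsShortExact i p) (h' : IsShortExact i' p') {l : K →ₗ[R] E × E'} {w : E × E' →ₗ[R] B}
    (hw : ∀ x, w x = p x.1 - p' x.2) (hlw : Function.Exact l w) (hl : Function.Injective l)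
    {j : A × A' →ₗ[R] K} {r : K →ₗ[R] B} (hj : ∀ a, l (j a) = (i a.1, i' a.2))
    (hr : ∀ x, r x = p (l x).1) : IsShortExact j r := by
  obtain ⟨h₁, h₂, h₃⟩ := h
  obtain ⟨h₁', h₂', h₃'⟩ := h'
  refine ⟨?_, fun x => ⟨fun hx => ?_, ?_⟩, fun b => ?_⟩
  · rintro ⟨a, b⟩ ⟨a', b'⟩ hab
    have := congrArg l hab
    rw [hj, hj, Prod.mk.injEq] at this
    exact Prod.ext (h₁ this.1) (h₁' this.2)
  · rw [hr] at hx
    have hx' := hlw.apply_apply_eq_zero x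
    rw [hw, hx, zero_sub, neg_eq_zero] at hx'
    obtain ⟨a, ha⟩ := (h₂ _).1 hx
    obtain ⟨a', ha'⟩ := (h₂' _).1 hx'
    exact ⟨(a, a'), hl (by rw [hj, ha, ha'])⟩
  · rintro ⟨a, rfl⟩
    rw [hr, hj, h₂.apply_apply_eq_zero]
  · obtain ⟨x, rfl⟩ := h₃ b
    obtain ⟨x', hx'⟩ := h₃' (p x)
    obtain ⟨k, hk⟩ := (hlw (x, x')).1 (by rw [hw, hx', sub_self])
    exact ⟨k, by rw [hr, hk]⟩

end ExactSequences

/-- The fibre product is the kernel of the difference map on the biproduct. -/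
theorem isPullback_of_isKernel {C : Type 1} [Category.{0} C] [Preadditive C] {X Y Z K : C}
    (D : BinaryBicone X Y) (total : D.fst ≫ D.inl + D.snd ≫ D.inr = 𝟙 D.pt) {p : X ⟶ Z} {q : Y ⟶ Z}
    (k : K ⟶ D.pt) [Mono k] (w : k ≫ (D.fst ≫ p - D.snd ≫ q) = 0)
    (lift : ∀ {T : C} (h : T ⟶ D.pt), h ≫ (D.fst ≫ p - D.snd ≫ q) = 0 → ∃ l, l ≫ k = h) :
    IsPullback (k ≫ D.fst) (k ≫ D.snd) p q := by
  have w' : (k ≫ D.fst) ≫ p = (k ≫ D.snd) ≫ q := by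
    simpa [sub_eq_zero] using w
  have H : ∀ s : PullbackCone p q, ∃ l : s.pt ⟶ K, l ≫ k = s.fst ≫ D.inl + s.snd ≫ D.inr :=
    fun s => lift _ (by simp [s.condition])
  choose l hl using H
  refine ⟨⟨w'⟩, ⟨PullbackCone.IsLimit.mk w' l ?_ ?_ ?_⟩⟩
  · intro s
    rw [reassoc_of% hl s]
    simp
  · intro s
    rw [reassoc_of% hl s]
    simp
  · intro s t h₁ h₂
    rw [← cancel_mono k, hl, ← Category.comp_id (t ≫ k), ← total, ← h₁, ← h₂]
    simp

/-! ### Pushouts as cokernels and fibre products as kernels -/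

section Bicone

variable {C : Type 1} [Category.{0} C] [Preadditive C] {A A' E E' B : C}

theorem bicone_sub_comp_fst (D : BinaryBicone E A') {i : A ⟶ E} {p : E ⟶ B} (f : A ⟶ A')
    (h : i ≫ p = 0) : (i ≫ D.inl - f ≫ D.inr) ≫ D.fst ≫ p = 0 := by
  simp [h]

theorem bicone_sub_comp_add (D : BinaryBicone E A') {i : A ⟶ E} {f : A ⟶ A'} {e : E ⟶ B}
    {j : A' ⟶ B} (h : i ≫ e = f ≫ j) :
    (i ≫ D.inl - f ≫ D.inr) ≫ (D.fst ≫ e + D.snd ≫ j) = 0 := by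
  simp [h]

theorem bicone_add_comp_sub (D : BinaryBicone A A') (D' : BinaryBicone E E') {i : A ⟶ E}
    {i' : A' ⟶ E'} {p : E ⟶ B} {p' : E' ⟶ B} (h : i ≫ p = 0) (h' : i' ≫ p' = 0) :
    (D.fst ≫ i ≫ D'.inl + D.snd ≫ i' ≫ D'.inr) ≫ (D'.fst ≫ p - D'.snd ≫ p') = 0 := by
  simp [h, h']

variable [HasShortExact C]

/-- The pushout is the cokernel of (i, -f) on S.E ⊕ A'; a morphism over f kills that map when paired
with the inclusion of A', so it descends. -/
theorem Extn.over_cokernel (f : A ⟶ A') (S : Extn B A) (T : Extn B A') (D : BinaryBicone S.E A')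
    (zero : ∀ U : Extn B A', U.i ≫ U.p = 0) (c : D.pt ⟶ T.E) (_ : Epi c)
    (w : (S.i ≫ D.inl - f ≫ D.inr) ≫ c = 0) (hi : D.inr ≫ c = T.i)
    (hp : c ≫ T.p = D.fst ≫ S.p)
    (desc : ∀ {Z : C} (h : D.pt ⟶ Z), (S.i ≫ D.inl - f ≫ D.inr) ≫ h = 0 → ∃ l, c ≫ l = h) :
    Extn.Over f S T ∧ ∀ U, Extn.Over f S U → Extn.Over (𝟙 A') T U := by
  refine ⟨⟨D.inl ≫ c, ?_, ?_⟩, ?_⟩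
  · rw [← hi]
    simpa [sub_eq_zero] using w
  · rw [Category.assoc, hp, D.inl_fst_assoc]
  · rintro U ⟨e, h₁, h₂⟩
    obtain ⟨l, hl⟩ := desc _ (bicone_sub_comp_add D h₁)
    refine ⟨l, ?_, ?_⟩
    · rw [← hi, Category.assoc, hl]
      simp
    · rw [← cancel_epi c, hp, reassoc_of% hl]
      simp [h₂, zero]

theorem Extn.exists_pullback_kernel (S : Extn B A) (T : Extn B A') (D : BinaryBicone A A')
    (D' : BinaryBicone S.E T.E) (total : D'.fst ≫ D'.inl + D'.snd ≫ D'.inr = 𝟙 D'.pt)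
    (W : Extn B D.pt) (k : W.E ⟶ D'.pt) (_ : Mono k) (w : k ≫ (D'.fst ≫ S.p - D'.snd ≫ T.p) = 0)
    (hi : W.i ≫ k = D.fst ≫ S.i ≫ D'.inl + D.snd ≫ T.i ≫ D'.inr) (hp : (k ≫ D'.fst) ≫ S.p = W.p)
    (lift : ∀ {Z : C} (h : Z ⟶ D'.pt), h ≫ (D'.fst ≫ S.p - D'.snd ≫ T.p) = 0 → ∃ l, l ≫ k = h) :
    ∃ (W : Extn B D.pt) (q₁ : W.E ⟶ S.E) (q₂ : W.E ⟶ T.E), IsPullback q₁ q₂ S.p T.p ∧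
      W.i ≫ q₁ = D.fst ≫ S.i ∧ W.i ≫ q₂ = D.snd ≫ T.i ∧ q₁ ≫ S.p = W.p :=
  ⟨W, k ≫ D'.fst, k ≫ D'.snd, isPullback_of_isKernel D' total k w lift,
    by rw [reassoc_of% hi]; simp, by rw [reassoc_of% hi]; simp, hp⟩

end Bicone

/-! ### Pushouts and fibre products of extensions of mixed Hodge structures -/

namespace MHS

variable {A A' B : MHS}

theorem kernelι_mono (g : A ⟶ B) : Mono (kernelι g) where
  right_cancellation _ _ h := hom_ext <| LinearMap.ext fun x =>
    kernelι_injective g (LinearMap.congr_fun (congrArg Hom.f h) x)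

theorem cokernelπ_epi (g : A ⟶ B) : Epi (cokernelπ g) where
  left_cancellation _ _ h := hom_ext <|
    (LinearMap.cancel_right (cokernelπ_surjective g)).1 (congrArg Hom.f h)

theorem kernelι_comp (g : A ⟶ B) : kernelι g ≫ g = 0 :=
  hom_ext (kernelι_exact g).linearMap_comp_eq_zero

theorem cokernelπ_comp (g : A ⟶ B) : g ≫ cokernelπ g = 0 :=
  hom_ext (cokernelπ_exact g).linearMap_comp_eq_zero

theorem isShortExact (S : Extn B A) : IsShortExact (Hom.f S.i) (Hom.f S.p) := S.exact

theorem i_comp_p (S : Extn B A) : S.i ≫ S.p = 0 :=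
  hom_ext (isShortExact S).2.1.linearMap_comp_eq_zero

theorem pushout_condition (f : A ⟶ A') (S : Extn B A) :
    (S.i ≫ (bicone S.E A').inl - f ≫ (bicone S.E A').inr) ≫ (bicone S.E A').fst ≫ S.p = 0 :=
  bicone_sub_comp_fst _ _ (i_comp_p S)

/-- The pushout of an extension of mixed Hodge structures. -/
def pushout (f : A ⟶ A') (S : Extn B A) : Extn B A' where
  E := cokernel (S.i ≫ (bicone S.E A').inl - f ≫ (bicone S.E A').inr)
  i := (bicone S.E A').inr ≫ cokernelπ _
  p := cokernelDesc _ ((bicone S.E A').fst ≫ S.p) (pushout_condition f S)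
  exact := (isShortExact S).pushout (f := Hom.f f)
    (u := Hom.f (S.i ≫ (bicone S.E A').inl - f ≫ (bicone S.E A').inr))
    (fun a => by
      rw [sub_f]
      exact Prod.ext (sub_zero _) (zero_sub _))
    (cokernelπ_exact _) (cokernelπ_surjective _) (fun _ => rfl) (fun _ => rfl)

theorem pullback_condition (S : Extn B A) (T : Extn B A') :
    ((bicone A A').fst ≫ S.i ≫ (bicone S.E T.E).inl +
      (bicone A A').snd ≫ T.i ≫ (bicone S.E T.E).inr) ≫
        ((bicone S.E T.E).fst ≫ S.p - (bicone S.E T.E).snd ≫ T.p) = 0 :=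
  bicone_add_comp_sub _ _ (i_comp_p S) (i_comp_p T)

/-- The fibre product over `B` of two extensions of `B`. -/
def pullback (S : Extn B A) (T : Extn B A') : Extn B (prod A A') where
  E := kernel ((bicone S.E T.E).fst ≫ S.p - (bicone S.E T.E).snd ≫ T.p)
  i := kernelLift _ _ (pullback_condition S T)
  p := (kernelι _ ≫ (bicone S.E T.E).fst) ≫ S.p
  exact := (isShortExact S).pullback (isShortExact T)
    (w := Hom.f ((bicone S.E T.E).fst ≫ S.p - (bicone S.E T.E).snd ≫ T.p))
    (fun x => by
      rw [sub_f]
      rfl)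
    (kernelι_exact _) (kernelι_injective _)
    (fun a => Prod.ext (add_zero _) (zero_add _)) (fun _ => rfl)

/-- The formal properties of extensions of mixed Hodge structures. -/
def extnSums : ExtnSums MHS where
  bicone := bicone
  total := bicone_total
  equiv_of_over := by
    rintro A B S T ⟨e, h₁, h₂⟩
    rw [Category.id_comp] at h₁
    exact ⟨isoOfBijective e ((isShortExact S).bijective (isShortExact T) (congrArg Hom.f h₁)
      (congrArg Hom.f h₂)), h₁, h₂⟩
  exists_pushout f S := ⟨pushout f S, Extn.over_cokernel f S (pushout f S) (bicone _ _)
    i_comp_p (cokernelπ _) (cokernelπ_epi _) (cokernelπ_comp _) rfl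
    (cokernelπ_desc _ _ (pushout_condition f S))
    fun h hh => ⟨cokernelDesc _ h hh, cokernelπ_desc _ _ _⟩⟩
  exists_pullback S T := Extn.exists_pullback_kernel S T (bicone _ _) (bicone _ _)
    (bicone_total _ _) (pullback S T) (kernelι _) (kernelι_mono _) (kernelι_comp _)
    (kernelLift_ι _ _ (pullback_condition S T)) rfl
    fun h hh => ⟨kernelLift _ h hh, kernelLift_ι _ _ _⟩
  nonempty A B := ⟨prod A B, inl A B, snd A B, IsShortExact.inl_snd⟩

end MHS

/-! ### Pushouts and fibre products of extensions of formal Hodge structures -/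

namespace FHS

variable {m : ℕ} {A A' B : FHS m}

theorem kernelι_mono (g : A ⟶ B) : Mono (kernelι g) where
  right_cancellation _ _ h := hom_ext ((MHS.kernelι_mono (Hom.et g)).right_cancellation _ _ (congrArg Hom.et h))
    ((LinearMap.cancel_left (Submodule.injective_subtype _)).1 (congrArg Hom.o h))
    fun i => (LinearMap.cancel_left (Submodule.injective_subtype _)).1
      (congrFun (congrArg Hom.φ h) i)

theorem cokernelπ_epi (g : A ⟶ B) : Epi (cokernelπ g) where
  left_cancellation _ _ h := hom_ext ((MHS.cokernelπ_epi (Hom.et g)).left_cancellation _ _ (congrArg Hom.et h))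
    ((LinearMap.cancel_right (Submodule.mkQ_surjective _)).1 (congrArg Hom.o h))
    fun i => (LinearMap.cancel_right (Submodule.mkQ_surjective _)).1
      (congrFun (congrArg Hom.φ h) i)

theorem kernelι_comp (g : A ⟶ B) : kernelι g ≫ g = 0 :=
  hom_ext (MHS.kernelι_comp _) (LinearMap.exact_subtype_ker_map _).linearMap_comp_eq_zero
    fun _ => (LinearMap.exact_subtype_ker_map _).linearMap_comp_eq_zero

theorem cokernelπ_comp (g : A ⟶ B) : g ≫ cokernelπ g = 0 :=
  hom_ext (MHS.cokernelπ_comp _) (LinearMap.exact_map_mkQ_range _).linearMap_comp_eq_zero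
    fun _ => (LinearMap.exact_map_mkQ_range _).linearMap_comp_eq_zero

theorem isShortExact_et (S : Extn B A) :
    IsShortExact (MHS.Hom.f (Hom.et S.i)) (MHS.Hom.f (Hom.et S.p)) := S.exact.1

theorem isShortExact_o (S : Extn B A) : IsShortExact (Hom.o S.i) (Hom.o S.p) := S.exact.2.1

theorem isShortExact_φ (S : Extn B A) (j : Fin (m + 1)) :
    IsShortExact (Hom.φ S.i j) (Hom.φ S.p j) := S.exact.2.2 j

theorem i_comp_p (S : Extn B A) : S.i ≫ S.p = 0 :=
  hom_ext (MHS.i_comp_p S.forget) (isShortExact_o S).2.1.linearMap_comp_eq_zero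
    fun j => (isShortExact_φ S j).2.1.linearMap_comp_eq_zero

theorem pushout_condition (f : A ⟶ A') (S : Extn B A) :
    (S.i ≫ (bicone S.E A').inl - f ≫ (bicone S.E A').inr) ≫ (bicone S.E A').fst ≫ S.p = 0 :=
  bicone_sub_comp_fst _ _ (i_comp_p S)

/-- The pushout of an extension of formal Hodge structures. -/
def pushout (f : A ⟶ A') (S : Extn B A) : Extn B A' where
  E := cokernel (S.i ≫ (bicone S.E A').inl - f ≫ (bicone S.E A').inr)
  i := (bicone S.E A').inr ≫ cokernelπ _
  p := cokernelDesc _ ((bicone S.E A').fst ≫ S.p) (pushout_condition f S)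
  exact := ⟨(MHS.pushout (Hom.et f) S.forget).exact,
    (isShortExact_o S).pushout (f := Hom.o f)
      (u := Hom.o (S.i ≫ (bicone S.E A').inl - f ≫ (bicone S.E A').inr))
      (fun a => by
        rw [sub_o]
        exact Prod.ext (sub_zero _) (zero_sub _))
      (LinearMap.exact_map_mkQ_range _) (Submodule.mkQ_surjective _) (fun _ => rfl) (fun _ => rfl),
    fun j => (isShortExact_φ S j).pushout (f := Hom.φ f j)
      (u := Hom.φ (S.i ≫ (bicone S.E A').inl - f ≫ (bicone S.E A').inr) j)
      (fun a => by
        rw [sub_φ]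
        exact Prod.ext (sub_zero _) (zero_sub _))
      (LinearMap.exact_map_mkQ_range _) (Submodule.mkQ_surjective _) (fun _ => rfl) (fun _ => rfl)⟩

theorem pullback_condition (S : Extn B A) (T : Extn B A') :
    ((bicone A A').fst ≫ S.i ≫ (bicone S.E T.E).inl +
      (bicone A A').snd ≫ T.i ≫ (bicone S.E T.E).inr) ≫
        ((bicone S.E T.E).fst ≫ S.p - (bicone S.E T.E).snd ≫ T.p) = 0 :=
  bicone_add_comp_sub _ _ (i_comp_p S) (i_comp_p T)

/-- The fibre product over `B` of two extensions of `B`. -/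
def pullback (S : Extn B A) (T : Extn B A') : Extn B (prod A A') where
  E := kernel ((bicone S.E T.E).fst ≫ S.p - (bicone S.E T.E).snd ≫ T.p)
  i := kernelLift _ _ (pullback_condition S T)
  p := (kernelι _ ≫ (bicone S.E T.E).fst) ≫ S.p
  exact := ⟨(MHS.pullback S.forget T.forget).exact,
    (isShortExact_o S).pullback (isShortExact_o T)
      (w := Hom.o ((bicone S.E T.E).fst ≫ S.p - (bicone S.E T.E).snd ≫ T.p))
      (fun x => by
        rw [sub_o]
        rfl)
      (LinearMap.exact_subtype_ker_map _) (Submodule.injective_subtype _)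
      (fun a => Prod.ext (add_zero _) (zero_add _)) (fun _ => rfl),
    fun j => (isShortExact_φ S j).pullback (isShortExact_φ T j)
      (w := Hom.φ ((bicone S.E T.E).fst ≫ S.p - (bicone S.E T.E).snd ≫ T.p) j)
      (fun x => by
        rw [sub_φ]
        rfl)
      (LinearMap.exact_subtype_ker_map _) (Submodule.injective_subtype _)
      (fun a => Prod.ext (add_zero _) (zero_add _)) (fun _ => rfl)⟩

/-- The formal properties of extensions of formal Hodge structures. -/
def extnSums : ExtnSums (FHS m) where
  bicone := bicone
  total := bicone_total
  equiv_of_over := by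
    rintro A B S T ⟨e, h₁, h₂⟩
    rw [Category.id_comp] at h₁
    exact ⟨isoOfBijective e ((isShortExact_et S).bijective (isShortExact_et T)
        (congrArg (fun h => MHS.Hom.f (Hom.et h)) h₁) (congrArg (fun h => MHS.Hom.f (Hom.et h)) h₂))
      ((isShortExact_o S).bijective (isShortExact_o T) (congrArg Hom.o h₁) (congrArg Hom.o h₂))
      fun j => (isShortExact_φ S j).bijective (isShortExact_φ T j)
        (congrFun (congrArg Hom.φ h₁) j) (congrFun (congrArg Hom.φ h₂) j), h₁, h₂⟩
  exists_pushout f S := ⟨pushout f S, Extn.over_cokernel f S (pushout f S) (bicone _ _)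
    i_comp_p (cokernelπ _) (cokernelπ_epi _) (cokernelπ_comp _) rfl
    (cokernelπ_desc _ _ (pushout_condition f S))
    fun h hh => ⟨cokernelDesc _ h hh, cokernelπ_desc _ _ _⟩⟩
  exists_pullback S T := Extn.exists_pullback_kernel S T (bicone _ _) (bicone _ _)
    (bicone_total _ _) (pullback S T) (kernelι _) (kernelι_mono _) (kernelι_comp _)
    (kernelLift_ι _ _ (pullback_condition S T)) rfl
    fun h hh => ⟨kernelLift _ h hh, kernelLift_ι _ _ _⟩
  nonempty A B := ⟨prod A B, inl A B, snd A B, IsShortExact.inl_snd, IsShortExact.inl_snd, fun _ => IsShortExact.inl_snd⟩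

end FHS

/-! ### The forgetful map on extensions -/

theorem exists_lift_of_mem_range {R P M N : Type*} [Ring R] [AddCommGroup P] [Module R P]
    [AddCommGroup M] [Module R M] [AddCommGroup N] [Module R N] [Module.Projective R P]
    (a : M →ₗ[R] N) (f : P →ₗ[R] N) (h : ∀ x, ∃ y, a y = f x) : ∃ g : P →ₗ[R] M, ∀ x, a (g x) = f x := by
  obtain ⟨g, hg⟩ := Module.projective_lifting_property a.rangeRestrict
    (f.codRestrict (LinearMap.range a) h) a.surjective_rangeRestrict
  exact ⟨g, fun x => congrArg Subtype.val (LinearMap.congr_fun hg x)⟩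

theorem exists_lift_of_injective {R P M N : Type*} [Ring R] [AddCommGroup P] [Module R P]
    [AddCommGroup M] [Module R M] [AddCommGroup N] [Module R N]
    (a : M →ₗ[R] N) (ha : Function.Injective a) (f : P →ₗ[R] N) (h : ∀ x, ∃ y, a y = f x) :
    ∃ g : P →ₗ[R] M, ∀ x, a (g x) = f x :=
  ⟨(LinearEquiv.ofInjective a ha).symm.toLinearMap ∘ₗ f.codRestrict (LinearMap.range a) h,
    fun x => congrArg Subtype.val ((LinearEquiv.ofInjective a ha).apply_symm_apply ⟨f x, h x⟩)⟩

/-! ### Lifting an extension of the étale parts -/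

namespace FHS

variable {m : ℕ}

/-- For the top index, `π` composed with `het` is the canonical map, whose image spans the quotient
of H_ℂ over ℂ. Lower indices follow by descending along `v`. -/
theorem π_surjective (X : FHS m) (i : Fin (m + 1)) : Function.Surjective (X.π i) := by
  induction i using Fin.reverseInduction with
  | last =>
    intro y
    obtain ⟨z, rfl⟩ := Submodule.Quotient.mk_surjective _ y
    rw [← LinearMap.mem_range]
    induction z using TensorProduct.induction_on with
    | zero => exact zero_mem _
    | tmul z h =>
      have : z ⊗ₜ[ℤ] h = z • ((1 : ℂ) ⊗ₜ[ℤ] h) := by simp [TensorProduct.smul_tmul']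
      rw [this, Submodule.Quotient.mk_smul]
      exact Submodule.smul_mem _ _ ⟨X.het h, X.π_het h⟩
    | add x y hx hy => exact add_mem hx hy
  | cast i ih =>
    intro y
    obtain ⟨z, rfl⟩ := Submodule.Quotient.mk_surjective _ y
    obtain ⟨x, hx⟩ := ih (Submodule.Quotient.mk z)
    exact ⟨X.v i x, by rw [X.π_v, hx]; rfl⟩

variable {X Y : FHS m} (S : Extn X.et Y.et)

/-- A formal Hodge structure with underlying mixed Hodge structure the given extension, and with
components `Ho` and `V` the direct sums. -/
def extensionObj (ρ : ∀ i, X.V i →ₗ[ℂ] S.E.HC ⧸ S.E.F (((i : ℕ) : ℤ) + 1))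
    (θ : ∀ i : Fin m, X.V i.succ →ₗ[ℂ] Y.V i.castSucc) (h : S.E.H →+ Y.V (Fin.last m))
    (hθ : ∀ i x, MHS.Hom.quot S.i _ (Y.π _ (θ i x)) =
      S.E.proj (by simp) (ρ i.succ x) - ρ i.castSucc (X.v i x))
    (hh : ∀ x, MHS.Hom.quot S.i _ (Y.π _ (h x)) =
      S.E.toQuot _ x - ρ (Fin.last m) (X.het (MHS.Hom.f S.p x))) : FHS m where
  et := S.E
  level := Y.level.of_exact X.level S.exact.1 S.exact.2.1
  Ho := Y.Ho × X.Ho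
  V i := Y.V i × X.V i
  v i := ((Y.v i).coprod (θ i)).prod (X.v i ∘ₗ LinearMap.snd ℂ _ _)
  π i := (MHS.Hom.quot S.i _ ∘ₗ Y.π i).coprod (ρ i)
  het := h.prod (X.het.comp (MHS.Hom.f S.p).toAddMonoidHom)
  ho := Y.ho.prodMap X.ho
  π_v i x := by
    change MHS.Hom.quot S.i _ (Y.π _ (Y.v i x.1 + θ i x.2)) + ρ _ (X.v i x.2) =
      S.E.proj _ (MHS.Hom.quot S.i _ (Y.π _ x.1) + ρ _ x.2)
    rw [map_add, map_add, hθ, Y.π_v, map_add, MHS.proj_quot]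
    abel
  π_het x := by
    change MHS.Hom.quot S.i _ (Y.π _ (h x)) + ρ _ (X.het (MHS.Hom.f S.p x)) = _
    rw [hh, sub_add_cancel]

/-- Every extension of the underlying mixed Hodge structures comes from an extension of formal
Hodge structures. -/
theorem exists_forget_eq (hX : Module.Free ℤ X.et.H) : ∃ T : Extn X Y, T.forget = S := by
  have hS := MHS.isShortExact S
  -- By exactness on quotients and surjectivity of `Y.π i`, anything that dies in the quotient of
  -- X_ℂ comes from `Y.V i`.
  have hlift : ∀ i (y : S.E.HC ⧸ S.E.F (((i : Fin (m + 1)) : ℤ) + 1)), MHS.Hom.quot S.p _ y = 0 →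
      ∃ x, (MHS.Hom.quot S.i _ ∘ₗ Y.π i) x = y := by
    intro i y hy
    obtain ⟨z, rfl⟩ := (MHS.quot_exact hS.2.1 _ y).1 hy
    obtain ⟨x, rfl⟩ := Y.π_surjective i z
    exact ⟨x, rfl⟩
  have hρ : ∀ i, ∃ ρ : X.V i →ₗ[ℂ] S.E.HC ⧸ S.E.F (((i : ℕ) : ℤ) + 1),
      ∀ x, MHS.Hom.quot S.p _ (ρ x) = X.π i x :=
    fun i => exists_lift_of_mem_range _ _ fun x => MHS.quot_surjective hS.2.2 _ _
  choose ρ hρ using hρ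
  -- Both ρ lift `X.π`, which commutes with `v`, so their discrepancy dies in the quotient of X_ℂ
  -- and lifts linearly to `Y.V`.
  have hθ : ∀ i : Fin m, ∃ θ : X.V i.succ →ₗ[ℂ] Y.V i.castSucc,
      ∀ x, MHS.Hom.quot S.i _ (Y.π _ (θ x)) =
        S.E.proj (by simp) (ρ i.succ x) - ρ i.castSucc (X.v i x) := by
    intro i
    refine exists_lift_of_mem_range (MHS.Hom.quot S.i _ ∘ₗ Y.π i.castSucc)
      ((S.E.proj (by simp)).comp (ρ i.succ) - (ρ i.castSucc).comp (X.v i)) fun x => hlift _ _ ?_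
    rw [LinearMap.sub_apply, map_sub, LinearMap.comp_apply, LinearMap.comp_apply, hρ, X.π_v,
      ← MHS.proj_quot, hρ, sub_self]
  choose θ hθ using hθ
  -- A section τ of groups exists by freeness; it need not respect the filtrations. The map α is the
  -- associated retraction onto the étale part of Y.
  obtain ⟨τ, hτ⟩ := exists_lift_of_mem_range (MHS.Hom.f S.p) LinearMap.id fun x => hS.2.2 x
  obtain ⟨α, hα⟩ := exists_lift_of_injective (MHS.Hom.f S.i) hS.1
    (LinearMap.id - τ ∘ₗ MHS.Hom.f S.p) fun x => (hS.2.1 _).1 (by simp [hτ])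
  -- The correction l measures the failure of ρ ∘ `X.het` to be the canonical map along τ; it lifts
  -- to `Y.V` because the étale part of X is free.
  obtain ⟨l, hl⟩ := exists_lift_of_mem_range
    ((MHS.Hom.quot S.i _ ∘ₗ Y.π (Fin.last m)).toAddMonoidHom.toIntLinearMap)
    (S.E.toQuot _ ∘ₗ τ - ((ρ (Fin.last m)).toAddMonoidHom.comp X.het).toIntLinearMap) fun x =>
      hlift _ _ <| by
        change MHS.Hom.quot S.p _ (S.E.toQuot _ (τ x) - ρ _ (X.het x)) = 0
        rw [map_sub, hρ, X.π_het, MHS.quot_toQuot, hτ, LinearMap.id_apply, sub_self]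
  have hl' : ∀ x, MHS.Hom.quot S.i _ (Y.π (Fin.last m) (l x)) =
    S.E.toQuot _ (τ x) - ρ _ (X.het x) := hl
  -- The first component of `het` is `Y.het` ∘ α + l ∘ p: the first term accounts for x - τ(p x),
  -- the second for τ(p x).
  have hh : ∀ x, MHS.Hom.quot S.i _
      (Y.π _ ((Y.het.comp α.toAddMonoidHom + (l ∘ₗ MHS.Hom.f S.p).toAddMonoidHom) x)) =
      S.E.toQuot _ x - ρ (Fin.last m) (X.het (MHS.Hom.f S.p x)) := by
    intro x
    change MHS.Hom.quot S.i _ (Y.π _ (Y.het (α x) + l (MHS.Hom.f S.p x))) = _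
    rw [map_add, map_add, Y.π_het, hl', MHS.quot_toQuot, hα, LinearMap.sub_apply, map_sub]
    simp
  have hα' : ∀ x, α (MHS.Hom.f S.i x) = x := fun x => hS.1 <| by
    rw [hα]
    simp [hS.2.1.apply_apply_eq_zero]
  refine ⟨⟨extensionObj S ρ θ _ hθ hh,
    Hom.mk S.i (LinearMap.inl ℂ _ _) (fun i => LinearMap.inl ℂ _ _) ?_ ?_ ?_ ?_,
    Hom.mk S.p (LinearMap.snd ℂ _ _) (fun i => LinearMap.snd ℂ _ _) (fun _ _ => rfl) ?_
      (fun _ => rfl) (fun _ => rfl), S.exact, IsShortExact.inl_snd, fun _ => IsShortExact.inl_snd⟩,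
    rfl⟩
  · intro i x
    exact Prod.ext ((add_zero _).symm.trans (congrArg _ (map_zero (θ i)).symm))
      (map_zero (X.v i)).symm
  · intro i x
    exact (congrArg _ (map_zero (ρ i))).trans (add_zero _)
  · intro x
    refine Prod.ext ?_ ?_
    · change Y.het x = Y.het (α (MHS.Hom.f S.i x)) + l (MHS.Hom.f S.p (MHS.Hom.f S.i x))
      rw [hα', hS.2.1.apply_apply_eq_zero, map_zero, add_zero]
    · change 0 = X.het (MHS.Hom.f S.p (MHS.Hom.f S.i x))
      rw [hS.2.1.apply_apply_eq_zero, map_zero]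
  · intro x
    exact Prod.ext rfl (map_zero X.ho).symm
  · intro i x
    change X.π i x.2 = MHS.Hom.quot S.p _ (MHS.Hom.quot S.i _ (Y.π i x.1) + ρ i x.2)
    rw [map_add, hρ, (MHS.quot_exact hS.2.1 _).apply_apply_eq_zero, zero_add]

end FHS

/-! ### Additivity of the forgetful map -/

theorem Extn.Over.forget {m : ℕ} {X Y Y' : FHS m} {f : Y ⟶ Y'} {S : Extn X Y} {T : Extn X Y'} :
    Extn.Over f S T → Extn.Over (FHS.Hom.et f) S.forget T.forget :=
  fun ⟨e, h₁, h₂⟩ => ⟨FHS.Hom.et e, congrArg FHS.Hom.et h₁, congrArg FHS.Hom.et h₂⟩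

/-- The map on `Ext¹` induced by the forgetful functor. -/
def forgetExt {m : ℕ} (X Y : FHS m) :
    Ext1 X Y → Ext1 ((FHS.forget m).obj X) ((FHS.forget m).obj Y) :=
  Quotient.map Extn.forget fun _ _ h => MHS.extnSums.equiv_of_over (Extn.over_of_equiv h).forget

/-- A witness W for the sum is forgotten to one on étale parts. The formula `add_push` holds for
arbitrary pairs of morphisms, so the biproducts of the two categories need not be compared. -/
theorem forgetExt_add {m : ℕ} {X Y : FHS m} (x y : Ext1 X Y) :
    forgetExt X Y (FHS.extnSums.add x y) =
      MHS.extnSums.add (forgetExt X Y x) (forgetExt X Y y) := by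
  obtain ⟨S, rfl⟩ := Quotient.exists_rep x
  obtain ⟨T, rfl⟩ := Quotient.exists_rep y
  obtain ⟨U, hU⟩ := Quotient.exists_rep (FHS.extnSums.add S.cls T.cls)
  obtain ⟨W, h₁, h₂, h₃⟩ := FHS.extnSums.add_cls_eq_iff.1 hU.symm
  have e₁ := MHS.extnSums.push_cls.2 h₁.forget
  have e₂ := MHS.extnSums.push_cls.2 h₂.forget
  have e₃ := MHS.extnSums.push_cls.2 h₃.forget
  refine (congrArg (forgetExt X Y) hU.symm).trans ?_
  change U.forget.cls = MHS.extnSums.add S.forget.cls T.forget.cls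
  exact (e₃.symm.trans (MHS.extnSums.add_push _ _ _).symm).trans (congrArg₂ _ e₁ e₂)

end

/-- For formal Hodge structures `X`, `Y` of level `≤ m + 1` whose étale parts are free abelian
groups, the Baer sum makes `Ext¹` (of formal Hodge structures, and of the underlying mixed Hodge
structures) an abelian group, and the forgetful functor `(H, V) ↦ H_et` induces a surjective
homomorphism between these groups. -/
theorem mainTheorem6 (m : ℕ) (X Y : FHS m)
    (hX : Module.Free ℤ X.et.H) (hY : Module.Free ℤ Y.et.H) :
    ∃ (_ : AddCommGroup (Ext1 X Y))
      (_ : AddCommGroup (Ext1 ((FHS.forget m).obj X) ((FHS.forget m).obj Y)))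
      (γ : Ext1 X Y →+ Ext1 ((FHS.forget m).obj X) ((FHS.forget m).obj Y)),
      (∀ S T U : Extn X Y, S.cls + T.cls = U.cls ↔ Extn.IsBaerSum S T U) ∧
      (∀ S T U : Extn ((FHS.forget m).obj X) ((FHS.forget m).obj Y),
        S.cls + T.cls = U.cls ↔ Extn.IsBaerSum S T U) ∧
      (∀ T : Extn X Y, γ T.cls = T.forget.cls) ∧
      Function.Surjective γ := by
  let _ : AddCommGroup (Ext1 X Y) := FHS.extnSums.addCommGroup Y X
  let _ : AddCommGroup (Ext1 ((FHS.forget m).obj X) ((FHS.forget m).obj Y)) :=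
    MHS.extnSums.addCommGroup _ _
  refine ⟨inferInstance, inferInstance, AddMonoidHom.mk' (forgetExt X Y) forgetExt_add,
    fun S T U => FHS.extnSums.isBaerSum_iff.symm, fun S T U => MHS.extnSums.isBaerSum_iff.symm,
    fun _ => rfl, fun y => ?_⟩
  obtain ⟨S, rfl⟩ := Quotient.exists_rep y
  obtain ⟨T, hT⟩ := FHS.exists_forget_eq S hX
  exact ⟨T.cls, congrArg Extn.cls hT⟩
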